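/- **Setting.** Write $e(z)=\exp(2\pi i z)$. Let $\Omega=N+iM$ be a complex symmetric $g\times g$ matrix with $M=\operatorname{Im}\Omega$ real symmetric of signature $(g-1,1)$, let $p,q\in\mathbb R^g$, and let $c,c_1,c_2\in\mathbb R^g$ satisfy $c^\top Mc<0$, $c_j^\top Mc_j<0$. Put $\mathcal E(\alpha)=\int_0^\alpha e^{-\pi u^2}\,du$ and $$\Theta^{c_1,c_2}(z;\Omega)=\sum_{n\in\mathbb Z^g}\Big[\mathcal E\Big(\tfrac{c_2^\top\operatorname{Im}(\Omega n+z)}{\sqrt{-\frac12c_2^\top Mc_2}}\Big)-\mathcal E\Big(\tfrac{c_1^\top\operatorname{Im}(\Omega n+z)}{\sqrt{-\frac12c_1^\top Mc_1}}\Big)\Big]e\big(\tfrac12n^\top\Omega n+n^\top z\big)$$ (positive square roots), $\Theta^{c_1,c_2}_{p,q}(\Omega)=e(\tfrac12q^\top\Omega q+p^\top q)\,\Theta^{c_1,c_2}(p+\Omega q;\Omega)$. The completed indefinite zeta function is $$\widehat\zeta^{c_1,c_2}_{p,q}(\Omega,s)=\int_0^\infty\Theta^{c_1,c_2}_{p,q}(t\Omega)\,t^s\,\frac{dt}t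 .$$ The cone Dirichlet series is $$\zeta^{c_1,c_2}_{p,q}(\Omega,s)=\tfrac12\sum_{m\in\mathbb Z^g+q}\big(\operatorname{sgn}(c_2^\top Mm)-\operatorname{sgn}(c_1^\top Mm)\big)e(p^\top m)\,\big(m^\top(-i\Omega)m\big)^{-s}$$ (principal powers; a summand is $0$ when the two signs agree), and the correction term is $$\xi^{c}_{p,q}(\Omega,s)=\frac1{2s}\sum_{m\in\mathbb Z^g+q}\operatorname{sgn}(c^\top Mm)\,e(p^\top m)\Big(\frac{(c^\top Mm)^2}{-\frac12c^\top Mc}\Big)^{-s}{}_2F_1\Big(s,s+\tfrac12;s+1;\frac{(c^\top Mc)\,(m^\top(-i\Omega)m)}{2(c^\top Mm)^2}\Big),$$ where summands with $c^\top Mm=0$ are $0$ and ${}_2F_1$ is the principal branch on $\mathbb C\setminus[1,\infty)$ of the Gauss hypergeometric function. For $P\in\mathrm{GL}_g(\mathbb Z)$ and $z\in\mathbb C^g$ the quadruple $(c_1,c_2,z,\Omega)$ is called $P$-stable if $P^\top\Omega P=\Omega$, $Pc_1=c_2$ and $P^\top z\equiv z\pmod{\mathbb Z^g}$. **Theorem.**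 Suppose that $(c_1,c_2,p+\Omega q,\Omega)$ is $P$-stable and let $\operatorname{Re}(s)>g/2$. Then the series $\xi^{c_1}_{p,q}(\Omega,s)$ and $\xi^{c_2}_{p,q}(\Omega,s)$ converge absolutely and $$\xi^{c_1}_{p,q}(\Omega,s)=\xi^{c_2}_{p,q}(\Omega,s).$$ If moreover $c_1$ and $c_2$ lie in the same component of $\{v\in\mathbb R^g: v^\top Mv<0\}$ (that is, $c_1^\top Mc_2<0$), then the series for $\Theta^{c_1,c_2}_{p,q}(t\Omega)$ ($t>0$) and for $\zeta^{c_1,c_2}_{p,q}(\Omega,s)$ and the integral for $\widehat\zeta^{c_1,c_2}_{p,q}(\Omega,s)$ converge absolutely, and $$\widehat\zeta^{c_1,c_2}_{p,q}(\Omega,s)=\pi^{-s}\,\Gamma(s)\,\zeta^{c_1,c_2}_{p,q}(\Omega,s).$$ -/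

import Mathlib

noncomputable section

namespace IndefZeta

open Matrix MeasureTheory

variable {g : ℕ}

/-- `e(z) = exp(2 π i z)`. -/
def e (z : ℂ) : ℂ := Complex.exp (2 * Real.pi * Complex.I * z)

/-- The form `v ↦ vᵀ Λ v` (without a factor `1/2`). -/
def qf {R : Type*} [CommRing R] (Λ : Matrix (Fin g) (Fin g) R) (v : Fin g → R) : R :=
  v ⬝ᵥ (Λ *ᵥ v)

/-- The imaginary part `M` of `Ω = N + iM`, taken entrywise. -/
def imPart (Ω : Matrix (Fin g) (Fin g) ℂ) : Matrix (Fin g) (Fin g) ℝ := Ω.map Complex.im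

/-- A real vector seen as a complex vector. -/
def toC (v : Fin g → ℝ) : Fin g → ℂ := fun i => (v i : ℂ)

/-- The real symmetric matrix `M` has exactly `j` positive and `k` negative eigenvalues,
counted with multiplicity. -/
def HasSignature (M : Matrix (Fin g) (Fin g) ℝ) (j k : ℕ) : Prop :=
  ∃ h : M.IsHermitian,
    (Finset.univ.filter fun i => 0 < h.eigenvalues i).card = j ∧
    (Finset.univ.filter fun i => h.eigenvalues i < 0).card = k

/-- The Siegel intermediate half-space of genus `g` and index `k`: the complex symmetric matrices
whose imaginary part has signature `(g - k, k)`. -/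
def siegelIntermediate (g k : ℕ) : Set (Matrix (Fin g) (Fin g) ℂ) :=
  {Ω | Ω.IsSymm ∧ ∃ j : ℕ, j + k = g ∧ HasSignature (imPart Ω) j k}

/-- `P`-stability of the quadruple `(c₁, c₂, z, Ω)`, for `P ∈ GL_g(ℤ)`. -/
structure IsPStable (P : GL (Fin g) ℤ) (c₁ c₂ : Fin g → ℝ) (z : Fin g → ℂ)
    (Ω : Matrix (Fin g) (Fin g) ℂ) : Prop where
  mem : Ω ∈ siegelIntermediate g 1
  neg₁ : qf (imPart Ω) c₁ < 0
  neg₂ : qf (imPart Ω) c₂ < 0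
  fix_form : ((P : Matrix (Fin g) (Fin g) ℤ).map (Int.cast : ℤ → ℂ))ᵀ * Ω *
    (P : Matrix (Fin g) (Fin g) ℤ).map (Int.cast : ℤ → ℂ) = Ω
  map_cone : (P : Matrix (Fin g) (Fin g) ℤ).map (Int.cast : ℤ → ℝ) *ᵥ c₁ = c₂
  fix_point : ∃ a : Fin g → ℤ,
    ((P : Matrix (Fin g) (Fin g) ℤ).map (Int.cast : ℤ → ℂ))ᵀ *ᵥ z = z + fun i => (a i : ℂ)

/-- The incomplete Gaussian integral `∫₀^α exp(-π u²) du`. -/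
def gaussInt (α : ℝ) : ℝ := ∫ u in (0 : ℝ)..α, Real.exp (-Real.pi * u ^ 2)

/-- The real number `cᵀ Im(Ω n + z) / √(-½ cᵀ Im(Ω) c)`, with the positive square root. -/
def thetaArg (c : Fin g → ℝ) (z : Fin g → ℂ) (Ω : Matrix (Fin g) (Fin g) ℂ) (n : Fin g → ℤ) : ℝ :=
  (c ⬝ᵥ fun i => ((Ω *ᵥ (fun j => (n j : ℂ)) + z) i).im) /
    Real.sqrt (-(1 / 2) * qf (imPart Ω) c)

/-- The summand of the indefinite theta function. -/
def thetaTerm (c₁ c₂ : Fin g → ℝ) (z : Fin g → ℂ) (Ω : Matrix (Fin g) (Fin g) ℂ)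
    (n : Fin g → ℤ) : ℂ :=
  ((gaussInt (thetaArg c₂ z Ω n) - gaussInt (thetaArg c₁ z Ω n) : ℝ) : ℂ) *
    e (1 / 2 * qf Ω (fun i => (n i : ℂ)) + (fun i => (n i : ℂ)) ⬝ᵥ z)

/-- The indefinite theta function `Θ^{c₁,c₂}(z; Ω)`, for real cone parameters. -/
def theta (c₁ c₂ : Fin g → ℝ) (z : Fin g → ℂ) (Ω : Matrix (Fin g) (Fin g) ℂ) : ℂ :=
  ∑' n : Fin g → ℤ, thetaTerm c₁ c₂ z Ω n

/-- The indefinite theta null with characteristics `Θ^{c₁,c₂}_{p,q}(Ω)`. -/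
def thetaChar (c₁ c₂ p q : Fin g → ℝ) (Ω : Matrix (Fin g) (Fin g) ℂ) : ℂ :=
  e (1 / 2 * qf Ω (toC q) + toC p ⬝ᵥ toC q) * theta c₁ c₂ (toC p + Ω *ᵥ toC q) Ω

/-- The function `t ↦ Θ^{c₁,c₂}_{p,q}(t Ω)`. -/
def thetaRay (c₁ c₂ p q : Fin g → ℝ) (Ω : Matrix (Fin g) (Fin g) ℂ) (t : ℝ) : ℂ :=
  thetaChar c₁ c₂ p q ((t : ℂ) • Ω)

/-- The completed indefinite zeta function `∫₀^∞ Θ^{c₁,c₂}_{p,q}(t Ω) t^s dt/t`. -/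
def completedZeta (c₁ c₂ p q : Fin g → ℝ) (Ω : Matrix (Fin g) (Fin g) ℂ) (s : ℂ) : ℂ :=
  mellin (thetaRay c₁ c₂ p q Ω) s

/-- The point `n + q` of the shifted lattice `ℤ^g + q`. -/
def shift (q : Fin g → ℝ) (n : Fin g → ℤ) : Fin g → ℝ := fun i => (n i : ℝ) + q i

/-- The summand of the cone Dirichlet series at the point `m = n + q`. -/
def coneTerm (c₁ c₂ p q : Fin g → ℝ) (Ω : Matrix (Fin g) (Fin g) ℂ) (s : ℂ)
    (n : Fin g → ℤ) : ℂ :=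
  ((Real.sign (c₂ ⬝ᵥ (imPart Ω *ᵥ shift q n)) -
      Real.sign (c₁ ⬝ᵥ (imPart Ω *ᵥ shift q n)) : ℝ) : ℂ) *
    e (toC p ⬝ᵥ toC (shift q n)) * (qf (-Complex.I • Ω) (toC (shift q n))) ^ (-s)

/-- The cone Dirichlet series (incomplete indefinite zeta function) `ζ^{c₁,c₂}_{p,q}(Ω, s)`. -/
def coneZeta (c₁ c₂ p q : Fin g → ℝ) (Ω : Matrix (Fin g) (Fin g) ℂ) (s : ℂ) : ℂ :=
  1 / 2 * ∑' n : Fin g → ℤ, coneTerm c₁ c₂ p q Ω s n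

/-- `F` is the principal branch of the Gauss hypergeometric function with parameters `a`, `b`, `c`:
it is analytic on `ℂ ∖ [1, ∞)` and given by the hypergeometric series on the unit disc. -/
def IsPrincipalHypergeometric (a b c : ℂ) (F : ℂ → ℂ) : Prop :=
  AnalyticOnNhd ℂ F {z : ℂ | 1 - z ∈ Complex.slitPlane} ∧
    ∀ z : ℂ, ‖z‖ < 1 → F z = ordinaryHypergeometric a b c z

open Classical in
/-- The value at `z ∈ ℂ ∖ [1, ∞)` of the principal branch of the Gauss hypergeometric function
(for `c` different from `0, -1, -2, …` the branch exists and it is unique on `ℂ ∖ [1, ∞)`). -/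
def hyp2F1 (a b c z : ℂ) : ℂ :=
  if h : ∃ F : ℂ → ℂ, IsPrincipalHypergeometric a b c F then h.choose z else 0

/-- The summand at `m = n + q` of the correction term. Here
`(cᵀMm)² / (-½ cᵀMc)` is a nonnegative real number, and the summand is `0` if `cᵀMm = 0`. -/
def xiTerm (c p q : Fin g → ℝ) (Ω : Matrix (Fin g) (Fin g) ℂ) (s : ℂ) (n : Fin g → ℤ) : ℂ :=
  (Real.sign (c ⬝ᵥ (imPart Ω *ᵥ shift q n)) : ℂ) * e (toC p ⬝ᵥ toC (shift q n)) *
    (((c ⬝ᵥ (imPart Ω *ᵥ shift q n)) ^ 2 / (-(1 / 2) * qf (imPart Ω) c) : ℝ) : ℂ) ^ (-s) *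
    hyp2F1 s (s + 1 / 2) (s + 1)
      (((qf (imPart Ω) c : ℝ) : ℂ) * qf (-Complex.I • Ω) (toC (shift q n)) /
        (2 * ((c ⬝ᵥ (imPart Ω *ᵥ shift q n) : ℝ) : ℂ) ^ 2))

/-- The correction term `ξ^c_{p,q}(Ω, s)`. -/
def xi (c p q : Fin g → ℝ) (Ω : Matrix (Fin g) (Fin g) ℂ) (s : ℂ) : ℂ :=
  1 / (2 * s) * ∑' n : Fin g → ℤ, xiTerm c p q Ω s n

end IndefZeta

end

/-! Put m = n + q and Q(m) = mᵀ(-iΩ)m, so that Re Q(m) = mᵀMm. Completing the square turns each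
theta summand along the ray tΩ into e(pᵀm) exp(-πQ(m)t) times a difference of two values of
`gaussInt`. Since `gaussInt` is odd with limit 1/2, each value is a sign times (1/2 minus a Gaussian
tail). Hence the theta series is a sign series, minus a tail series for c₂, plus a tail series for
c₁ (`e_mul_thetaTerm_smul`).

Each of the three series is dominated by a positive definite Gaussian. In the sign series only
vectors separating c₁ and c₂ survive, and M is positive there
(`HasSignature.exists_separating_bound`). In a tail series the decay of the tail replaces M by a
positive definite majorant (`HasSignature.exists_majorant_bound`). For Re s > g/2 this permits
termwise Mellin transforms (`hasSum_mellin_of_norm_le_exp`). The sign series gives π^(-s) Γ(s) times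
the cone series. A tail summand gives Euler's integral for ₂F₁, hence a summand of ξ
(`mellin_gaussTail_mul_exp`). The completed zeta function is therefore the cone term plus a constant
times the difference of ξ at c₁ and ξ at c₂ (`hasMellin_thetaRay`).

Stability forces Pq = q and makes e(pᵀm) invariant under m ↦ Pm, so P permutes ℤ^g + q and carries
the summands of ξ at c₁ to those at c₂ (`IsPStable.xiTerm_latticeEquiv`). The two corrections are
equal and cancel. -/

noncomputable section

namespace IndefZeta

open Matrix MeasureTheory

variable {g : ℕ}

/-! ### Lorentzian quadratic forms: positivity and uniform lower bounds. -/

section LinearAlgebra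

variable {M : Matrix (Fin g) (Fin g) ℝ}

lemma dotProduct_mulVec_comm_of_isSymm {R : Type*} [CommRing R] {A : Matrix (Fin g) (Fin g) R}
    (hA : A.IsSymm) (v w : Fin g → R) : v ⬝ᵥ (A *ᵥ w) = w ⬝ᵥ (A *ᵥ v) := by
  rw [dotProduct_mulVec, ← mulVec_transpose, hA.eq, dotProduct_comm]

lemma qf_smul {R : Type*} [CommRing R] (A : Matrix (Fin g) (Fin g) R) (a : R) (v : Fin g → R) :
    qf A (a • v) = a ^ 2 * qf A v := by
  simp only [qf, mulVec_smul, smul_dotProduct, dotProduct_smul, smul_eq_mul]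
  ring

lemma qf_add {R : Type*} [CommRing R] {A : Matrix (Fin g) (Fin g) R} (hA : A.IsSymm)
    (v w : Fin g → R) : qf A (v + w) = qf A v + 2 * (v ⬝ᵥ (A *ᵥ w)) + qf A w := by
  simp only [qf, mulVec_add, add_dotProduct, dotProduct_add,
    dotProduct_mulVec_comm_of_isSymm hA w v]
  ring

lemma qf_eq_sum_eigenvalues (h : M.IsHermitian) (v : Fin g → ℝ) :
    qf M v = ∑ i, h.eigenvalues i * ((h.eigenvectorBasis i).ofLp ⬝ᵥ v) ^ 2 := by
  have hsymm : M.IsSymm := by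
    have := h.eq
    rwa [conjTranspose_eq_transpose_of_trivial] at this
  have key := h.eigenvectorBasis.sum_inner_mul_inner (WithLp.toLp 2 v) (WithLp.toLp 2 (M *ᵥ v))
  have hR : inner ℝ (WithLp.toLp 2 v) (WithLp.toLp 2 (M *ᵥ v)) = qf M v := by
    simp [qf, EuclideanSpace.inner_eq_star_dotProduct, dotProduct_comm]
  rw [hR] at key
  rw [← key]
  refine Finset.sum_congr rfl fun i _ => ?_
  have h1 : inner ℝ (WithLp.toLp 2 v) (h.eigenvectorBasis i)
      = (h.eigenvectorBasis i).ofLp ⬝ᵥ v := by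
    simp [EuclideanSpace.inner_eq_star_dotProduct]
  have h2 : inner ℝ (h.eigenvectorBasis i) (WithLp.toLp 2 (M *ᵥ v))
      = h.eigenvalues i * ((h.eigenvectorBasis i).ofLp ⬝ᵥ v) := by
    simp only [EuclideanSpace.inner_eq_star_dotProduct, star_trivial]
    rw [dotProduct_comm, dotProduct_mulVec_comm_of_isSymm hsymm, h.mulVec_eigenvectorBasis,
      dotProduct_smul, dotProduct_comm, smul_eq_mul]
  rw [h1, h2]
  ring

lemma HasSignature.isSymm {j k : ℕ} (h : HasSignature M j k) : M.IsSymm := by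
  obtain ⟨h, -⟩ := h
  have := h.eq
  rwa [conjTranspose_eq_transpose_of_trivial] at this

/-- A symmetric form of signature `(g - 1, 1)` is positive on some hyperplane. -/
lemma HasSignature.exists_hyperplane_pos {j : ℕ} (hj : j + 1 = g) (h : HasSignature M j 1) :
    ∃ u : Fin g → ℝ, ∀ v, u ⬝ᵥ v = 0 → v ≠ 0 → 0 < qf M v := by
  obtain ⟨h, hpos, hneg⟩ := h
  obtain ⟨i₀, hi₀⟩ := Finset.card_eq_one.mp hneg
  have hi₀' : h.eigenvalues i₀ < 0 := by
    have : i₀ ∈ Finset.univ.filter fun i => h.eigenvalues i < 0 := by simp [hi₀]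
    simpa using this
  have hothers : ∀ i, i ≠ i₀ → 0 < h.eigenvalues i := by
    have hsub : (Finset.univ.filter fun i => 0 < h.eigenvalues i) ⊆ Finset.univ.erase i₀ := by
      intro i hi
      simp only [Finset.mem_filter, Finset.mem_univ, true_and] at hi
      simp only [Finset.mem_erase, Finset.mem_univ, and_true]
      rintro rfl
      linarith
    have hcard : (Finset.univ.erase i₀).card ≤
        (Finset.univ.filter fun i => 0 < h.eigenvalues i).card := by
      rw [hpos, Finset.card_erase_of_mem (Finset.mem_univ _), Finset.card_univ, Fintype.card_fin]
      omega
    have heq := Finset.eq_of_subset_of_card_le hsub hcard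
    intro i hi
    have : i ∈ Finset.univ.filter fun i => 0 < h.eigenvalues i := by
      rw [heq]
      simp [hi]
    simpa using this
  refine ⟨(h.eigenvectorBasis i₀).ofLp, fun v hv hv0 => ?_⟩
  rw [qf_eq_sum_eigenvalues h]
  have hnn : ∀ i ∈ Finset.univ,
      0 ≤ h.eigenvalues i * ((h.eigenvectorBasis i).ofLp ⬝ᵥ v) ^ 2 := by
    intro i _
    by_cases hi : i = i₀
    · subst hi
      simp [hv]
    · exact mul_nonneg (hothers i hi).le (sq_nonneg _)
  refine lt_of_le_of_ne (Finset.sum_nonneg hnn) fun h0 => hv0 ?_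
  have hz := (Finset.sum_eq_zero_iff_of_nonneg hnn).mp h0.symm
  have hall : ∀ i, inner ℝ (h.eigenvectorBasis i) (WithLp.toLp 2 v) = 0 := by
    intro i
    have h1 : inner ℝ (h.eigenvectorBasis i) (WithLp.toLp 2 v)
        = (h.eigenvectorBasis i).ofLp ⬝ᵥ v := by
      simp [EuclideanSpace.inner_eq_star_dotProduct, dotProduct_comm]
    rw [h1]
    by_cases hi : i = i₀
    · subst hi
      exact hv
    · have := hz i (Finset.mem_univ i)
      rcases mul_eq_zero.mp this with h2 | h2
      · exact absurd h2 (hothers i hi).ne'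
      · exact pow_eq_zero_iff (two_ne_zero) |>.mp h2
  have hv0' : WithLp.toLp 2 v = 0 := by
    rw [← h.eigenvectorBasis.sum_repr' (WithLp.toLp 2 v)]
    simp [hall]
  simpa using hv0'

/-- The orthogonal complement of a negative vector of a Lorentzian form is positive definite. -/
lemma HasSignature.qf_pos_of_orthogonal {j : ℕ} (hj : j + 1 = g) (h : HasSignature M j 1)
    {c w : Fin g → ℝ} (hc : qf M c < 0) (hcw : c ⬝ᵥ (M *ᵥ w) = 0) (hw : w ≠ 0) : 0 < qf M w := by
  obtain ⟨u, hu⟩ := h.exists_hyperplane_pos hj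
  by_contra! hle
  have hsymm := h.isSymm
  -- The combination of c and w annihilated by u: the form is positive at v unless v = 0, while c ⟂
  -- w and qf w ≤ 0 make it nonpositive.
  set v : Fin g → ℝ := (u ⬝ᵥ w) • c + (-(u ⬝ᵥ c)) • w with hv
  have huv : u ⬝ᵥ v = 0 := by
    simp only [hv, dotProduct_add, dotProduct_smul, smul_eq_mul]
    ring
  have hqv : qf M v = (u ⬝ᵥ w) ^ 2 * qf M c + (u ⬝ᵥ c) ^ 2 * qf M w := by
    rw [hv, qf_add hsymm, qf_smul, qf_smul, mulVec_smul, smul_dotProduct, dotProduct_smul, hcw]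
    simp
  have huc : u ⬝ᵥ c ≠ 0 := by
    intro h0
    have hc0 : c ≠ 0 := by
      rintro rfl
      simp [qf] at hc
    linarith [hu c h0 hc0]
  have hv0 : v = 0 := by
    by_contra hv0
    have := hu v huv hv0
    nlinarith [sq_nonneg (u ⬝ᵥ w), sq_nonneg (u ⬝ᵥ c)]
  have h1 : c ⬝ᵥ (M *ᵥ v) = (u ⬝ᵥ w) * qf M c := by
    simp [hv, mulVec_add, mulVec_smul, mulVec_neg, dotProduct_add, hcw, qf]
  rw [hv0, mulVec_zero, dotProduct_zero] at h1
  have h2 : u ⬝ᵥ w = 0 := by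
    rcases mul_eq_zero.mp h1.symm with h2 | h2
    · exact h2
    · linarith
  have h3 := hu w h2 hw
  linarith

lemma HasSignature.mulVec_injective {j : ℕ} (hj : j + 1 = g) (h : HasSignature M j 1)
    {c : Fin g → ℝ} (hc : qf M c < 0) {x : Fin g → ℝ} (hx : M *ᵥ x = 0) : x = 0 := by
  by_contra hx0
  have := h.qf_pos_of_orthogonal hj hc (w := x) (by simp [hx]) hx0
  simp [qf, hx] at this

/-- The majorant `v ↦ vᵀMv + (cᵀMv)² / (-½ cᵀMc)` of a Lorentzian form is positive definite. -/
lemma HasSignature.majorant_pos {j : ℕ} (hj : j + 1 = g) (h : HasSignature M j 1)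
    {c v : Fin g → ℝ} (hc : qf M c < 0) (hv : v ≠ 0) :
    0 < qf M v + (c ⬝ᵥ (M *ᵥ v)) ^ 2 / (-(1 / 2) * qf M c) := by
  set r : ℝ := (c ⬝ᵥ (M *ᵥ v)) / qf M c with hr
  set w : Fin g → ℝ := v - r • c with hw
  have hcw : c ⬝ᵥ (M *ᵥ w) = 0 := by
    simp only [hw, mulVec_sub, mulVec_smul, dotProduct_sub, dotProduct_smul, smul_eq_mul]
    change _ - r * qf M c = 0
    rw [hr, div_mul_cancel₀ _ hc.ne, sub_self]
  have hvw : v = r • c + w := by simp [hw]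
  have hqv : qf M v = r ^ 2 * qf M c + qf M w := by
    conv_lhs => rw [hvw]
    rw [qf_add h.isSymm, qf_smul, smul_dotProduct, hcw]
    simp
  have hsum : qf M v + (c ⬝ᵥ (M *ᵥ v)) ^ 2 / (-(1 / 2) * qf M c) =
      r ^ 2 * (-qf M c) + qf M w := by
    rw [hqv, hr]
    field_simp
    ring
  rw [hsum]
  by_cases hw0 : w = 0
  · have hr0 : r ≠ 0 := by
      rintro h0
      apply hv
      rw [hvw, hw0, h0]
      simp
    have : 0 < r ^ 2 := by positivity
    rw [hw0]
    have h0 : qf M (0 : Fin g → ℝ) = 0 := by simp [qf]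
    rw [h0]
    nlinarith
  · have := h.qf_pos_of_orthogonal hj hc hcw hw0
    nlinarith [sq_nonneg r]

/-- A Lorentzian form is positive on the vectors separating two negative vectors
of the same component. -/
lemma HasSignature.qf_pos_of_separating {j : ℕ} (hj : j + 1 = g) (h : HasSignature M j 1)
    {c₁ c₂ v : Fin g → ℝ} (hc₁ : qf M c₁ < 0) (hc₂ : qf M c₂ < 0) (hc : c₁ ⬝ᵥ (M *ᵥ c₂) < 0)
    (hsep : (c₁ ⬝ᵥ (M *ᵥ v)) * (c₂ ⬝ᵥ (M *ᵥ v)) ≤ 0) (hv : v ≠ 0) : 0 < qf M v := by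
  set a := c₁ ⬝ᵥ (M *ᵥ v) with ha
  set b := c₂ ⬝ᵥ (M *ᵥ v) with hb
  by_cases ha0 : a = 0
  · exact h.qf_pos_of_orthogonal hj hc₁ ha0 hv
  -- This vector is orthogonal to v by construction. Since -ab ≥ 0 and a² > 0, it is a nonnegative
  -- combination of two negative vectors in one component, hence negative.
  refine h.qf_pos_of_orthogonal hj (c := (-(a * b)) • c₁ + (a ^ 2) • c₂) ?_ ?_ hv
  · rw [qf_add h.isSymm, qf_smul, qf_smul, mulVec_smul, smul_dotProduct, dotProduct_smul,
      smul_eq_mul, smul_eq_mul]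
    have h1 : 0 < a ^ 2 := by positivity
    have h2 : (a ^ 2) ^ 2 * qf M c₂ < 0 := mul_neg_of_pos_of_neg (by positivity) hc₂
    have h3 : (-(a * b)) ^ 2 * qf M c₁ ≤ 0 := mul_nonpos_of_nonneg_of_nonpos (sq_nonneg _) hc₁.le
    have h4 : 2 * (-(a * b) * (a ^ 2 * (c₁ ⬝ᵥ (M *ᵥ c₂)))) ≤ 0 := by
      have : (-(a * b)) * a ^ 2 * (c₁ ⬝ᵥ (M *ᵥ c₂)) ≤ 0 :=
        mul_nonpos_of_nonneg_of_nonpos (mul_nonneg (by linarith) h1.le) hc.le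
      nlinarith
    linarith
  · simp only [add_dotProduct, smul_dotProduct, smul_eq_mul, ← ha, ← hb]
    ring

/-- A continuous function homogeneous of degree two and positive on a closed cone is bounded below
on it by a multiple of the squared norm. -/
lemma exists_pos_mul_norm_sq_le {E : Type*} [NormedAddCommGroup E] [NormedSpace ℝ E]
    [ProperSpace E] {f : E → ℝ} (hf : Continuous f)
    (hhom : ∀ (r : ℝ) v, f (r • v) = r ^ 2 * f v) {S : Set E} (hS : IsClosed S)
    (hScone : ∀ (r : ℝ), ∀ v ∈ S, r • v ∈ S) (hpos : ∀ v ∈ S, v ≠ 0 → 0 < f v) :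
    ∃ δ > 0, ∀ v ∈ S, δ * ‖v‖ ^ 2 ≤ f v := by
  have hcomp : IsCompact (Metric.sphere (0 : E) 1 ∩ S) := (isCompact_sphere 0 1).inter_right hS
  obtain ⟨δ, hδ, hδ'⟩ : ∃ δ > 0, ∀ v ∈ Metric.sphere (0 : E) 1 ∩ S, δ ≤ f v := by
    rcases (Metric.sphere (0 : E) 1 ∩ S).eq_empty_or_nonempty with he | hne
    · exact ⟨1, one_pos, by simp [he]⟩
    · obtain ⟨v, hv, hmin⟩ := hcomp.exists_isMinOn hne hf.continuousOn
      refine ⟨f v, hpos v hv.2 ?_, fun w hw => hmin hw⟩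
      rintro rfl
      simp at hv
  refine ⟨δ, hδ, fun v hv => ?_⟩
  by_cases hv0 : v = 0
  · subst hv0
    have := hhom 0 0
    simp at this
    simp [this]
  have hn : ‖v‖ ≠ 0 := norm_ne_zero_iff.mpr hv0
  have h1 := hδ' (‖v‖⁻¹ • v) ⟨by simp [norm_smul, hn], hScone _ _ hv⟩
  rw [hhom] at h1
  have h2 : 0 < ‖v‖ ^ 2 := by positivity
  calc δ * ‖v‖ ^ 2 ≤ (‖v‖⁻¹ ^ 2 * f v) * ‖v‖ ^ 2 := by gcongr
    _ = f v := by field_simp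

lemma continuous_qf (M : Matrix (Fin g) (Fin g) ℝ) : Continuous (qf M) := by
  unfold qf dotProduct mulVec dotProduct
  fun_prop

lemma continuous_dotProduct_mulVec (M : Matrix (Fin g) (Fin g) ℝ) (c : Fin g → ℝ) :
    Continuous fun v => c ⬝ᵥ (M *ᵥ v) := by
  unfold dotProduct mulVec dotProduct
  fun_prop

lemma HasSignature.exists_majorant_bound {j : ℕ} (hj : j + 1 = g) (h : HasSignature M j 1)
    {c : Fin g → ℝ} (hc : qf M c < 0) :
    ∃ δ > 0, ∀ v, δ * ‖v‖ ^ 2 ≤ qf M v + (c ⬝ᵥ (M *ᵥ v)) ^ 2 / (-(1 / 2) * qf M c) := by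
  obtain ⟨δ, hδ, hb⟩ := exists_pos_mul_norm_sq_le (S := Set.univ)
    (f := fun v => qf M v + (c ⬝ᵥ (M *ᵥ v)) ^ 2 / (-(1 / 2) * qf M c))
    ((continuous_qf M).add (((continuous_dotProduct_mulVec M c).pow 2).div_const _))
    (fun r v => by
      simp only [qf_smul, mulVec_smul, dotProduct_smul, smul_eq_mul]
      ring) isClosed_univ (fun _ _ _ => Set.mem_univ _)
    (fun v _ hv => h.majorant_pos hj hc hv)
  exact ⟨δ, hδ, fun v => hb v (Set.mem_univ v)⟩

lemma HasSignature.exists_separating_bound {j : ℕ} (hj : j + 1 = g) (h : HasSignature M j 1)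
    {c₁ c₂ : Fin g → ℝ} (hc₁ : qf M c₁ < 0) (hc₂ : qf M c₂ < 0) (hc : c₁ ⬝ᵥ (M *ᵥ c₂) < 0) :
    ∃ δ > 0, ∀ v, (c₁ ⬝ᵥ (M *ᵥ v)) * (c₂ ⬝ᵥ (M *ᵥ v)) ≤ 0 → δ * ‖v‖ ^ 2 ≤ qf M v := by
  exact exists_pos_mul_norm_sq_le
    (S := {v | (c₁ ⬝ᵥ (M *ᵥ v)) * (c₂ ⬝ᵥ (M *ᵥ v)) ≤ 0}) (continuous_qf M) (fun r v => qf_smul M r v)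
    (isClosed_le ((continuous_dotProduct_mulVec M c₁).mul (continuous_dotProduct_mulVec M c₂))
      continuous_const)
    (fun r v hv => by
      simp only [Set.mem_ofPred_eq, mulVec_smul, dotProduct_smul, smul_eq_mul] at hv ⊢
      nlinarith [sq_nonneg r, mul_nonneg (sq_nonneg r) (neg_nonneg.mpr hv)])
    (fun v hv hv0 => h.qf_pos_of_separating hj hc₁ hc₂ hc hv hv0)

end LinearAlgebra

/-- Convergence of the Epstein-type series over a shifted lattice. -/
lemma summable_norm_shift_rpow (q : Fin g → ℝ) {r : ℝ} (hr : r < -g) :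
    Summable fun n : Fin g → ℤ => ‖shift q n‖ ^ r := by
  let b := Pi.basisFun ℝ (Fin g)
  let L := Submodule.span ℤ (Set.range b)
  have hfr : Module.finrank ℤ L = g := by
    rw [ZLattice.rank ℝ L]
    simp
  have h1 := ZLattice.summable_norm_sub_rpow L r (by rw [hfr]; exact hr) (-q)
  let φ : (Fin g → ℤ) → L := fun n => ⟨fun i => (n i : ℝ), by
    have : (fun i => (n i : ℝ)) = ∑ i, n i • b i := by
      ext i
      simp [b, Finset.sum_apply, Pi.single_apply]
    rw [this]
    exact Submodule.sum_mem _ fun i _ =>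
      Submodule.smul_mem _ _ (Submodule.subset_span (Set.mem_range_self i))⟩
  have hφ : Function.Injective φ := by
    intro n m hnm
    ext i
    have := congrFun (congrArg Subtype.val hnm) i
    simpa [φ] using this
  refine (h1.comp_injective hφ).congr fun n => ?_
  simp only [Function.comp_apply, φ, sub_neg_eq_add]
  rfl

/-! ### Euler's integral and the principal branch of ₂F₁. -/

section Hypergeometric

open Set Filter Topology

/-- Euler's integral for `₂F₁(a, b; b + 1; z)`, in the variable `u = 1 / y`. -/
def eulerInt (a b z : ℂ) : ℂ :=
  b * ∫ u in Ioi (1 : ℝ), (u : ℂ) ^ (-b - 1) * (1 - z / u) ^ (-a)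

/-- The slit plane is star-shaped about 1. With θ = 1/u this keeps 1 - z/u off the cut for every u ≥
1. -/
lemma one_sub_mul_mem_slitPlane {z : ℂ} (hz : 1 - z ∈ Complex.slitPlane) {θ : ℝ} (h0 : 0 ≤ θ)
    (h1 : θ ≤ 1) : 1 - (θ : ℂ) * z ∈ Complex.slitPlane := by
  have := Complex.starConvex_one_slitPlane hz (sub_nonneg.mpr h1) h0 (sub_add_cancel 1 θ)
  convert! this using 1
  simp only [Complex.real_smul]
  push_cast
  ring

lemma isOpen_principalDomain : IsOpen {z : ℂ | 1 - z ∈ Complex.slitPlane} :=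
  Complex.isOpen_slitPlane.preimage (by fun_prop)

lemma isPreconnected_principalDomain : IsPreconnected {z : ℂ | 1 - z ∈ Complex.slitPlane} := by
  have : StarConvex ℝ (0 : ℂ) {z : ℂ | 1 - z ∈ Complex.slitPlane} := by
    rw [starConvex_zero_iff]
    intro z hz θ h0 h1
    simpa using one_sub_mul_mem_slitPlane hz h0 h1
  exact (this.isPathConnected (by simp)).isConnected.isPreconnected

lemma continuousOn_eulerIntegrand (a b : ℂ) {z : ℂ} (hz : 1 - z ∈ Complex.slitPlane) :
    ContinuousOn (fun u : ℝ => (u : ℂ) ^ (-b - 1) * (1 - z / u) ^ (-a)) (Ioi 1) := by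
  intro u hu
  have hu0 : (0 : ℝ) < u := lt_trans one_pos hu
  refine ContinuousAt.continuousWithinAt (ContinuousAt.mul ?_ ?_)
  · exact Complex.continuousAt_ofReal_cpow_const _ _ (Or.inr hu0.ne')
  · refine ContinuousAt.cpow (continuousAt_const.sub (continuousAt_const.div
      Complex.continuous_ofReal.continuousAt (by exact_mod_cast hu0.ne'))) continuousAt_const ?_
    have := one_sub_mul_mem_slitPlane hz (inv_nonneg.mpr hu0.le) (inv_le_one_of_one_le₀ (le_of_lt hu))
    convert! this using 1
    push_cast
    field_simp

/-- In the variable θ = 1/u the unbounded range u > 1 sits inside the compact interval [0, 1], and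
the power is still continuous at θ = 0. The resulting locally uniform bound serves both
integrability and differentiation under the integral. -/
lemma exists_bound_one_sub_mul_cpow (w : ℂ) {z₀ : ℂ} (hz₀ : 1 - z₀ ∈ Complex.slitPlane) :
    ∃ C, ∃ s ∈ 𝓝 z₀, (∀ z ∈ s, 1 - z ∈ Complex.slitPlane) ∧
      ∀ z ∈ s, ∀ u : ℝ, 1 < u → ‖(1 - z / u) ^ w‖ ≤ C := by
  obtain ⟨ε, hε, hball⟩ := Metric.nhds_basis_closedBall.mem_iff.mp
    (isOpen_principalDomain.mem_nhds hz₀)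
  have hcomp : IsCompact (Metric.closedBall z₀ ε ×ˢ Icc (0 : ℝ) 1) :=
    (isCompact_closedBall _ _).prod isCompact_Icc
  have hcont : ContinuousOn (fun p : ℂ × ℝ => (1 - (p.2 : ℂ) * p.1) ^ w)
      (Metric.closedBall z₀ ε ×ˢ Icc (0 : ℝ) 1) := by
    refine ContinuousOn.cpow (by fun_prop) continuousOn_const ?_
    rintro ⟨z, θ⟩ ⟨h1, h2⟩
    exact one_sub_mul_mem_slitPlane (hball h1) h2.1 h2.2
  obtain ⟨C, hC⟩ := hcomp.exists_bound_of_continuousOn hcont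
  refine ⟨C, _, Metric.closedBall_mem_nhds z₀ hε, fun z hz => hball hz, fun z hz u hu => ?_⟩
  have hu0 : (0 : ℝ) < u := lt_trans one_pos hu
  have := hC (z, u⁻¹) ⟨hz, inv_nonneg.mpr hu0.le, inv_le_one_of_one_le₀ hu.le⟩
  convert! this using 3
  push_cast
  field_simp

lemma integrableOn_norm_cpow_Ioi_one {b : ℂ} (hb : 0 < b.re) :
    IntegrableOn (fun u : ℝ => ‖(u : ℂ) ^ (-b - 1)‖) (Ioi 1) :=
  (integrableOn_Ioi_cpow_of_lt (a := -b - 1) (by simp; linarith) one_pos).norm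

lemma integrableOn_eulerIntegrand (a : ℂ) {b z : ℂ} (hb : 0 < b.re)
    (hz : 1 - z ∈ Complex.slitPlane) :
    IntegrableOn (fun u : ℝ => (u : ℂ) ^ (-b - 1) * (1 - z / u) ^ (-a)) (Ioi 1) := by
  obtain ⟨C, s, hs, -, hC⟩ := exists_bound_one_sub_mul_cpow (-a) hz
  refine Integrable.mono' ((integrableOn_norm_cpow_Ioi_one hb).mul_const C)
    ((continuousOn_eulerIntegrand a b hz).aestronglyMeasurable measurableSet_Ioi) ?_
  refine (ae_restrict_mem measurableSet_Ioi).mono fun u hu => ?_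
  rw [norm_mul]
  exact mul_le_mul_of_nonneg_left (hC z (mem_of_mem_nhds hs) u hu) (norm_nonneg _)

lemma differentiableAt_eulerInt (a : ℂ) {b z₀ : ℂ} (hb : 0 < b.re)
    (hz₀ : 1 - z₀ ∈ Complex.slitPlane) : DifferentiableAt ℂ (eulerInt a b) z₀ := by
  obtain ⟨C, s, hs, hsub, hC⟩ := exists_bound_one_sub_mul_cpow (-a - 1) hz₀
  have hC0 : 0 ≤ C := (norm_nonneg _).trans (hC z₀ (mem_of_mem_nhds hs) 2 one_lt_two)
  refine DifferentiableAt.const_mul ?_ b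
  refine (hasDerivAt_integral_of_dominated_loc_of_deriv_le (𝕜 := ℂ) hs
    (μ := volume.restrict (Ioi (1 : ℝ)))
    (F := fun z (u : ℝ) => (u : ℂ) ^ (-b - 1) * (1 - z / u) ^ (-a))
    (F' := fun z (u : ℝ) => (u : ℂ) ^ (-b - 1) * (-a * (1 - z / u) ^ (-a - 1) * (-1 / u)))
    (bound := fun u : ℝ => ‖(u : ℂ) ^ (-b - 1)‖ * (‖a‖ * C)) ?_
    (integrableOn_eulerIntegrand a hb hz₀) ?_ ?_ ?_ ?_).2.differentiableAt
  · filter_upwards [hs] with z hz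
    exact (continuousOn_eulerIntegrand a b (hsub z hz)).aestronglyMeasurable measurableSet_Ioi
  · refine ContinuousOn.aestronglyMeasurable ?_ measurableSet_Ioi
    have h1 := continuousOn_eulerIntegrand (a + 1) b hz₀
    have h2 : ContinuousOn (fun u : ℝ => -a * (-1 / (u : ℂ))) (Ioi 1) := by
      refine continuousOn_const.mul (continuousOn_const.div
        Complex.continuous_ofReal.continuousOn fun u hu => ?_)
      exact_mod_cast (lt_trans one_pos hu).ne'
    refine (h1.mul h2).congr fun u _ => ?_
    rw [show -(a + 1) = -a - 1 by ring]
    simp only [Pi.mul_apply]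
    ring
  · refine (ae_restrict_mem measurableSet_Ioi).mono fun u hu z hz => ?_
    have hu0 : (0 : ℝ) < u := lt_trans one_pos hu
    rw [norm_mul, norm_mul, norm_mul, norm_neg]
    refine mul_le_mul_of_nonneg_left ?_ (norm_nonneg _)
    have h1 : ‖(-1 : ℂ) / u‖ ≤ 1 := by
      rw [norm_div, norm_neg, norm_one, Complex.norm_real, Real.norm_of_nonneg hu0.le]
      exact (div_le_one hu0).mpr (le_of_lt hu)
    calc ‖a‖ * ‖(1 - z / (u : ℂ)) ^ (-a - 1)‖ * ‖(-1 : ℂ) / u‖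
        ≤ ‖a‖ * C * 1 := by
          gcongr
          exact hC z hz u hu
      _ = ‖a‖ * C := mul_one _
  · exact (integrableOn_norm_cpow_Ioi_one hb).mul_const _
  · refine (ae_restrict_mem measurableSet_Ioi).mono fun u hu z hz => ?_
    have hu0 : (0 : ℝ) < u := lt_trans one_pos hu
    refine HasDerivAt.const_mul _ ?_
    have h1 : HasDerivAt (fun z : ℂ => 1 - z / (u : ℂ)) (-1 / u) z := by
      have := ((hasDerivAt_id z).div_const (u : ℂ)).const_sub 1
      convert! this using 1
      ring
    refine h1.cpow_const ?_
    have := one_sub_mul_mem_slitPlane (hsub z hz) (inv_nonneg.mpr hu0.le)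
      (inv_le_one_of_one_le₀ (le_of_lt hu))
    convert! this using 1
    push_cast
    field_simp

lemma hasSum_one_sub_cpow_neg (a : ℂ) {w : ℂ} (hw : ‖w‖ < 1) :
    HasSum (fun n : ℕ => ((n.factorial : ℂ)⁻¹ * (ascPochhammer ℂ n).eval a) * w ^ n)
      ((1 - w) ^ (-a)) := by
  have h := (Complex.one_add_cpow_hasFPowerSeriesOnBall_zero (a := -a)).hasSum (y := -w)
    (by simpa [← ENNReal.ofReal_one, Metric.eball_ofReal] using hw)
  rw [zero_add, ← sub_eq_add_neg] at h
  convert! h using 1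
  ext n
  -- The binomial series is ₂F₁(a, b; b; w) for any admissible b; with b = 1 the two equal
  -- Pochhammer factors cancel.
  rw [binomialSeries_eq_ordinaryHypergeometricSeries (b := 1)
    (fun k => by norm_cast), neg_neg]
  have h1 : (ascPochhammer ℂ n).eval (1 : ℂ) ≠ 0 := by
    simp [ascPochhammer_eval_one, Nat.factorial_ne_zero]
  simp only [FormalMultilinearSeries.compContinuousLinearMap_apply]
  have := ordinaryHypergeometricSeries_apply_eq a 1 1 w n
  simp only [mul_assoc, mul_inv_cancel₀ h1, mul_one, smul_eq_mul] at this
  rw [← mul_assoc] at this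
  rw [← this]
  congr 1
  ext i
  simp

lemma ascPochhammer_eval_succ_ne_zero {b : ℂ} (hb : 0 < b.re) (n : ℕ) :
    (ascPochhammer ℂ n).eval (b + 1) ≠ 0 := by
  rw [Ne, ascPochhammer_eval_eq_zero_iff]
  rintro ⟨k, -, hk⟩
  have := congrArg Complex.re hk
  simp at this
  have h0 : (0 : ℝ) ≤ k := k.cast_nonneg
  linarith

/-- Splitting off the first or the last factor of the rising factorial of length n + 1 gives two
expressions for the same product. The quotient b/(b + n) is b times the integral of u^(-b-n-1) over
u > 1. -/
lemma ascPochhammer_eval_div {b : ℂ} (hb : 0 < b.re) (n : ℕ) :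
    (ascPochhammer ℂ n).eval b * ((ascPochhammer ℂ n).eval (b + 1))⁻¹ = b / (b + n) := by
  have h1 : (ascPochhammer ℂ (n + 1)).eval b = b * (ascPochhammer ℂ n).eval (b + 1) := by
    rw [ascPochhammer_succ_left]
    simp
  have h2 := ascPochhammer_succ_eval n b
  have h3 : b + n ≠ 0 := by
    intro h
    have := congrArg Complex.re h
    simp at this
    have h0 : (0 : ℝ) ≤ n := n.cast_nonneg
    linarith
  have h4 := ascPochhammer_eval_succ_ne_zero hb n
  rw [h1] at h2
  field_simp
  rw [← h2, mul_comm]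

/-- Expand (1 - z/u)^(-a) by the binomial series and integrate term by term. -/
lemma eulerInt_eq_ordinaryHypergeometric (a : ℂ) {b z : ℂ} (hb : 0 < b.re) (hz : ‖z‖ < 1) :
    eulerInt a b z = ordinaryHypergeometric a b (b + 1) z := by
  set c : ℕ → ℂ := fun n => (n.factorial : ℂ)⁻¹ * (ascPochhammer ℂ n).eval a with hc
  have hre : ∀ n : ℕ, (-(b + n) - 1).re < -1 := fun n => by
    have h0 : (0 : ℝ) ≤ n := n.cast_nonneg
    simp
    linarith
  have hsum := hasSum_integral_of_summable_integral_norm (μ := volume.restrict (Ioi (1 : ℝ)))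
    (F := fun (n : ℕ) (u : ℝ) => (c n * z ^ n) * (u : ℂ) ^ (-(b + n) - 1)) (fun n =>
      (integrableOn_Ioi_cpow_of_lt (hre n) one_pos).const_mul _) ?_
  · have hint : ∫ u in Ioi (1 : ℝ), ∑' n : ℕ, (c n * z ^ n) * (u : ℂ) ^ (-(b + n) - 1) =
        ∫ u in Ioi (1 : ℝ), (u : ℂ) ^ (-b - 1) * (1 - z / u) ^ (-a) := by
      refine setIntegral_congr_fun measurableSet_Ioi fun u hu => ?_
      have hu0 : (0 : ℝ) < u := lt_trans one_pos hu
      have hzu : ‖z / (u : ℂ)‖ < 1 := by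
        rw [norm_div, Complex.norm_real, Real.norm_of_nonneg hu0.le, div_lt_one hu0]
        exact hz.trans hu
      rw [← ((hasSum_one_sub_cpow_neg a hzu).mul_left ((u : ℂ) ^ (-b - 1))).tsum_eq]
      refine tsum_congr fun n => ?_
      have huC : (u : ℂ) ≠ 0 := by exact_mod_cast hu0.ne'
      rw [show -(b + n) - 1 = (-b - 1) - n by ring, Complex.cpow_sub _ _ huC, Complex.cpow_natCast,
        div_pow]
      ring
    rw [hint] at hsum
    rw [eulerInt, ← (hsum.mul_left b).tsum_eq, ordinaryHypergeometric_eq_tsum]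
    refine tsum_congr fun n => ?_
    rw [integral_const_mul, integral_Ioi_cpow_of_lt (hre n) one_pos, mul_assoc _ _ (_⁻¹),
      ascPochhammer_eval_div hb, smul_eq_mul, Complex.ofReal_one, Complex.one_cpow]
    rw [show -(b + n) - 1 + 1 = -(b + n) by ring, neg_div_neg_eq]
    simp only [hc]
    ring
  -- On u > 1 the extra factor u^(-n) has modulus at most 1, so the integrated norms are dominated
  -- by the absolutely convergent binomial series at z.
  · have h1 : Summable fun n : ℕ => ‖c n * z ^ n‖ :=
      (hasSum_one_sub_cpow_neg a hz).summable.norm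
    refine Summable.of_nonneg_of_le (fun n => integral_nonneg fun u => norm_nonneg _) (fun n => ?_)
      (h1.mul_right (∫ u in Ioi (1 : ℝ), ‖(u : ℂ) ^ (-b - 1)‖))
    simp only [norm_mul _ ((_ : ℂ) ^ (_ : ℂ))]
    rw [integral_const_mul]
    refine mul_le_mul_of_nonneg_left ?_ (norm_nonneg _)
    refine setIntegral_mono_on (integrableOn_Ioi_cpow_of_lt (hre n) one_pos).norm
      (integrableOn_norm_cpow_Ioi_one hb) measurableSet_Ioi fun u hu => ?_
    have hu0 : (0 : ℝ) < u := lt_trans one_pos hu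
    rw [Complex.norm_cpow_eq_rpow_re_of_pos hu0, Complex.norm_cpow_eq_rpow_re_of_pos hu0]
    refine Real.rpow_le_rpow_of_exponent_le (le_of_lt hu) ?_
    have h0 : (0 : ℝ) ≤ n := n.cast_nonneg
    simp [h0]

lemma isPrincipalHypergeometric_eulerInt (a : ℂ) {b : ℂ} (hb : 0 < b.re) :
    IsPrincipalHypergeometric a b (b + 1) (eulerInt a b) :=
  ⟨DifferentiableOn.analyticOnNhd
    (fun _ hz => (differentiableAt_eulerInt a hb hz).differentiableWithinAt) isOpen_principalDomain,
    fun _ hz => eulerInt_eq_ordinaryHypergeometric a hb hz⟩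

/-- Identity theorem on a star-shaped domain. It makes the value chosen in `hyp2F1` independent of
the choice. -/
lemma IsPrincipalHypergeometric.eqOn {a b c : ℂ} {F G : ℂ → ℂ}
    (hF : IsPrincipalHypergeometric a b c F) (hG : IsPrincipalHypergeometric a b c G) :
    EqOn F G {z : ℂ | 1 - z ∈ Complex.slitPlane} := by
  refine hF.1.eqOn_of_preconnected_of_eventuallyEq hG.1 isPreconnected_principalDomain
    (z₀ := 0) (by simp) ?_
  filter_upwards [Metric.ball_mem_nhds (0 : ℂ) one_pos] with z hz
  have hz' : ‖z‖ < 1 := by simpa using hz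
  rw [hF.2 z hz', hG.2 z hz']

/-- Euler's integral is set up with third parameter equal to the second plus 1, whereas ξ has the
parameter s, matching s + 1, in first position. -/
lemma hyp2F1_symm (a b c z : ℂ) : hyp2F1 a b c z = hyp2F1 b a c z := by
  have : IsPrincipalHypergeometric a b c = IsPrincipalHypergeometric b a c := by
    unfold IsPrincipalHypergeometric ordinaryHypergeometric
    rw [ordinaryHypergeometricSeries_symm a b c]
  unfold hyp2F1
  rw [this]

lemma hyp2F1_eq_eulerInt (a : ℂ) {b z : ℂ} (hb : 0 < b.re) (hz : 1 - z ∈ Complex.slitPlane) :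
    hyp2F1 a b (b + 1) z = eulerInt a b z := by
  have hex : ∃ F, IsPrincipalHypergeometric a b (b + 1) F :=
    ⟨_, isPrincipalHypergeometric_eulerInt a hb⟩
  rw [hyp2F1, dif_pos hex]
  exact hex.choose_spec.eqOn (isPrincipalHypergeometric_eulerInt a hb) hz

end Hypergeometric

/-! ### Mellin transforms of complex exponentials. -/

section MellinExp

open Set Filter Topology

/-- A positive factor does not change the argument, so principal logarithms add. -/
lemma ofReal_mul_cpow {x : ℝ} (hx : 0 < x) {w : ℂ} (hw : w ≠ 0) (a : ℂ) :
    ((x : ℂ) * w) ^ a = (x : ℂ) ^ a * w ^ a := by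
  have hx' : (x : ℂ) ≠ 0 := by exact_mod_cast hx.ne'
  rw [Complex.cpow_def_of_ne_zero (mul_ne_zero hx' hw), Complex.cpow_def_of_ne_zero hx',
    Complex.cpow_def_of_ne_zero hw, Complex.log_ofReal_mul hx hw, ← Complex.exp_add,
    Complex.ofReal_log hx.le]
  ring_nf

lemma integrableOn_rpow_mul_exp {σ b : ℝ} (hσ : 0 < σ) (hb : 0 < b) :
    IntegrableOn (fun t : ℝ => t ^ (σ - 1) * Real.exp (-(b * t))) (Ioi 0) := by
  have := integrableOn_rpow_mul_exp_neg_mul_rpow (s := σ - 1) (p := 1) (b := b) (by linarith)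
    one_pos hb
  simpa using this

/-- A function on the half-line dominated by a decaying exponential has a Mellin transform. -/
lemma mellinConvergent_of_norm_le_exp {f : ℝ → ℂ} {C b : ℝ} {s : ℂ} (hs : 0 < s.re) (hb : 0 < b)
    (hf : ContinuousOn f (Ioi 0)) (hle : ∀ t, 0 < t → ‖f t‖ ≤ C * Real.exp (-(b * t))) :
    MellinConvergent f s := by
  refine Integrable.mono' ((integrableOn_rpow_mul_exp hs hb).const_mul C) ?_ ?_
  · have h1 : ContinuousOn (fun t : ℝ => (t : ℂ) ^ (s - 1)) (Ioi 0) := fun t ht =>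
      (Complex.continuousAt_ofReal_cpow_const _ _ (Or.inr (ne_of_gt ht))).continuousWithinAt
    exact (h1.smul hf).aestronglyMeasurable measurableSet_Ioi
  · refine (ae_restrict_mem measurableSet_Ioi).mono fun t ht => ?_
    have ht0 : (0 : ℝ) < t := ht
    rw [norm_smul, Complex.norm_cpow_eq_rpow_re_of_pos ht0, Complex.sub_re, Complex.one_re]
    calc t ^ (s.re - 1) * ‖f t‖ ≤ t ^ (s.re - 1) * (C * Real.exp (-(b * t))) := by
          gcongr
          exact hle t ht0
      _ = _ := by ring

lemma norm_exp_neg_mul_ofReal (r : ℂ) (t : ℝ) :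
    ‖Complex.exp (-(r * t))‖ = Real.exp (-(r.re * t)) := by
  rw [Complex.norm_exp]
  simp

lemma mellinConvergent_exp_neg_mul {s r : ℂ} (hs : 0 < s.re) (hr : 0 < r.re) :
    MellinConvergent (fun t : ℝ => Complex.exp (-(r * t))) s :=
  mellinConvergent_of_norm_le_exp (C := 1) hs hr (by fun_prop) fun t _ => by
    rw [norm_exp_neg_mul_ofReal, one_mul]

lemma differentiableAt_mellin_exp_neg_mul {s r₀ : ℂ} (hs : 0 < s.re) (hr₀ : 0 < r₀.re) :
    DifferentiableAt ℂ (fun r : ℂ => mellin (fun t : ℝ => Complex.exp (-(r * t))) s) r₀ := by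
  -- Near r₀ all exponentials are dominated by the one with rate Re r₀ / 2; the derivative in r
  -- brings down a factor t, which replaces s by s + 1.
  have hnhds : {r : ℂ | r₀.re / 2 < r.re} ∈ 𝓝 r₀ :=
    (isOpen_lt continuous_const Complex.continuous_re).mem_nhds (by simpa using hr₀)
  have hs1 : 0 < (s + 1).re := by
    simp
    linarith
  refine (hasDerivAt_integral_of_dominated_loc_of_deriv_le (𝕜 := ℂ) hnhds
    (μ := volume.restrict (Ioi (0 : ℝ)))
    (F := fun r (t : ℝ) => (t : ℂ) ^ (s - 1) • Complex.exp (-(r * t)))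
    (F' := fun r (t : ℝ) => -((t : ℂ) ^ (s + 1 - 1) • Complex.exp (-(r * t))))
    (bound := fun t => t ^ ((s + 1).re - 1) * Real.exp (-(r₀.re / 2 * t))) ?_
    (mellinConvergent_exp_neg_mul hs hr₀) (mellinConvergent_exp_neg_mul hs1 hr₀).1.neg ?_
    (integrableOn_rpow_mul_exp hs1 (half_pos hr₀)) ?_).2.differentiableAt
  · filter_upwards [hnhds] with r hr
    exact (mellinConvergent_exp_neg_mul hs (lt_trans (half_pos hr₀) hr)).1
  · refine (ae_restrict_mem measurableSet_Ioi).mono fun t ht r hr => ?_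
    have ht0 : (0 : ℝ) < t := ht
    rw [norm_neg, norm_smul, Complex.norm_cpow_eq_rpow_re_of_pos ht0, norm_exp_neg_mul_ofReal,
      Complex.sub_re, Complex.one_re]
    have hr' : r₀.re / 2 < r.re := hr
    gcongr
  · refine (ae_restrict_mem measurableSet_Ioi).mono fun t ht r hr => ?_
    have ht0 : (t : ℂ) ≠ 0 := by exact_mod_cast (ne_of_gt ht : t ≠ 0)
    have h1 : HasDerivAt (fun r : ℂ => -(r * t)) (-(1 * t)) r :=
      ((hasDerivAt_id r).mul_const (t : ℂ)).neg
    convert! (h1.cexp.const_smul ((t : ℂ) ^ (s - 1))) using 1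
    rw [show s + 1 - 1 = (s - 1) + 1 by ring, Complex.cpow_add _ _ ht0, Complex.cpow_one]
    simp only [smul_eq_mul]
    ring

/-- The Mellin transform of `t ↦ exp(-rt)` for complex `r` in the right half-plane. -/
lemma mellin_exp_neg_mul {s r : ℂ} (hs : 0 < s.re) (hr : 0 < r.re) :
    mellin (fun t : ℝ => Complex.exp (-(r * t))) s = r ^ (-s) * Complex.Gamma s := by
  have hopen : IsOpen {r : ℂ | 0 < r.re} := isOpen_lt continuous_const Complex.continuous_re
  have hF : AnalyticOnNhd ℂ (fun r : ℂ => mellin (fun t : ℝ => Complex.exp (-(r * t))) s)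
      {r : ℂ | 0 < r.re} :=
    DifferentiableOn.analyticOnNhd (fun r hr =>
      (differentiableAt_mellin_exp_neg_mul hs hr).differentiableWithinAt) hopen
  have hG : AnalyticOnNhd ℂ (fun r : ℂ => r ^ (-s) * Complex.Gamma s) {r : ℂ | 0 < r.re} :=
    DifferentiableOn.analyticOnNhd (fun r hr => DifferentiableAt.differentiableWithinAt <|
      (differentiableAt_id.cpow_const (Or.inl hr)).mul_const _) hopen
  -- Both sides are analytic in r on the right half-plane and agree for positive real r, a set
  -- accumulating at 1.
  refine hF.eqOn_of_preconnected_of_frequently_eq hG (convex_halfSpace_re_gt 0).isPreconnected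
    (z₀ := 1) (by simp) ?_ hr
  have h_real : ∀ x : ℝ, 0 < x → mellin (fun t : ℝ => Complex.exp (-((x : ℂ) * t))) s =
      (x : ℂ) ^ (-s) * Complex.Gamma s := by
    intro x hx
    have := Complex.integral_cpow_mul_exp_neg_mul_Ioi hs hx
    rw [mellin]
    simp only [smul_eq_mul]
    rw [this, one_div, Complex.inv_cpow _ _
      (by rw [Complex.arg_ofReal_of_nonneg hx.le]; exact Real.pi_pos.ne), Complex.cpow_neg]
  have h1 : ∃ᶠ x : ℝ in 𝓝[≠] (1 : ℝ),
      mellin (fun t : ℝ => Complex.exp (-((x : ℂ) * t))) s = (x : ℂ) ^ (-s) * Complex.Gamma s := by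
    refine Eventually.frequently ?_
    filter_upwards [nhdsWithin_le_nhds (Ioi_mem_nhds (zero_lt_one' ℝ))] with x hx
    exact h_real x hx
  have h2 : Tendsto (fun x : ℝ => (x : ℂ)) (𝓝[≠] 1) (𝓝[≠] ((1 : ℝ) : ℂ)) :=
    Complex.continuous_ofReal.continuousWithinAt.tendsto_nhdsWithin (fun x hx => by simpa using hx)
  exact h2.frequently h1

end MellinExp

/-! ### The incomplete Gaussian integral and its tail. -/

section GaussInt

open Set Filter Topology

lemma hasDerivAt_gaussInt (α : ℝ) : HasDerivAt gaussInt (Real.exp (-Real.pi * α ^ 2)) α :=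
  intervalIntegral.integral_hasDerivAt_right
    (Continuous.intervalIntegrable (by fun_prop) _ _)
    (Continuous.stronglyMeasurableAtFilter (by fun_prop) _ _)
    (Continuous.continuousAt (by fun_prop))

lemma continuous_gaussInt : Continuous gaussInt :=
  continuous_iff_continuousAt.mpr fun α => (hasDerivAt_gaussInt α).continuousAt

lemma gaussInt_zero : gaussInt 0 = 0 := by
  simp [gaussInt]

lemma gaussInt_neg (α : ℝ) : gaussInt (-α) = -gaussInt α := by
  have := intervalIntegral.integral_comp_neg (a := 0) (b := α)
    (fun u : ℝ => Real.exp (-Real.pi * u ^ 2))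
  simp only [neg_zero, even_two, Even.neg_pow] at this
  rw [gaussInt, intervalIntegral.integral_symm, ← this, gaussInt]

lemma tendsto_gaussInt : Tendsto gaussInt atTop (𝓝 (1 / 2)) := by
  have h := intervalIntegral_tendsto_integral_Ioi (μ := volume) (0 : ℝ)
    (integrable_exp_neg_mul_sq Real.pi_pos).integrableOn tendsto_id
  rw [integral_gaussian_Ioi, div_self Real.pi_ne_zero, Real.sqrt_one] at h
  exact h

/-- The complementary incomplete Gaussian integral `∫_α^∞ exp(-π u²) du`. -/
def gaussTail (α : ℝ) : ℝ := 1 / 2 - gaussInt α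

lemma continuous_gaussTail : Continuous gaussTail := continuous_const.sub continuous_gaussInt

lemma gaussInt_eq_sign_mul (α r : ℝ) :
    gaussInt (r * α) = Real.sign α * (1 / 2 - gaussTail (r * |α|)) := by
  rcases lt_trichotomy α 0 with h | h | h
  · rw [Real.sign_of_neg h, abs_of_neg h, gaussTail, mul_neg, gaussInt_neg]
    ring
  · simp [h, gaussInt_zero]
  · rw [Real.sign_of_pos h, abs_of_pos h, gaussTail]
    ring

lemma gaussTail_nonneg (α : ℝ) : 0 ≤ gaussTail α := by
  have hmono : Monotone gaussInt := monotone_of_hasDerivAt_nonneg hasDerivAt_gaussInt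
    fun _ => (Real.exp_pos _).le
  exact sub_nonneg.mpr (hmono.ge_of_tendsto tendsto_gaussInt α)

/-- For u, α ≥ 0 one has (u + α)² ≥ u² + α², so shifting the integral by α gains the factor
exp(-πα²). The remaining factor 1/2 is discarded. -/
lemma gaussTail_le {α : ℝ} (hα : 0 ≤ α) : gaussTail α ≤ Real.exp (-Real.pi * α ^ 2) := by
  have h1 : ∀ x, 0 ≤ x → gaussInt (x + α) - gaussInt α ≤
      Real.exp (-Real.pi * α ^ 2) * gaussInt x := by
    intro x hx
    have hc : Continuous fun u : ℝ => Real.exp (-Real.pi * u ^ 2) := by fun_prop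
    rw [gaussInt, gaussInt, intervalIntegral.integral_interval_sub_left
      (hc.intervalIntegrable _ _) (hc.intervalIntegrable _ _)]
    have := intervalIntegral.integral_comp_add_right (a := 0) (b := x)
      (fun u : ℝ => Real.exp (-Real.pi * u ^ 2)) α
    rw [zero_add] at this
    rw [← this, gaussInt, ← intervalIntegral.integral_const_mul]
    refine intervalIntegral.integral_mono_on hx (Continuous.intervalIntegrable (by fun_prop) _ _)
      (Continuous.intervalIntegrable (by fun_prop) _ _) fun u hu => ?_
    rw [← Real.exp_add]
    refine Real.exp_le_exp.mpr ?_
    have : 0 ≤ Real.pi * (u * α) := mul_nonneg Real.pi_pos.le (mul_nonneg hu.1 hα)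
    nlinarith
  have h2 : Tendsto (fun x => gaussInt (x + α) - gaussInt α) atTop (𝓝 (1 / 2 - gaussInt α)) :=
    (tendsto_gaussInt.comp (tendsto_atTop_add_const_right _ _ tendsto_id)).sub_const _
  have h3 := le_of_tendsto_of_tendsto h2 (tendsto_gaussInt.const_mul (Real.exp (-Real.pi * α ^ 2)))
    (by filter_upwards [eventually_ge_atTop 0] with x hx using h1 x hx)
  have := Real.exp_pos (-Real.pi * α ^ 2)
  rw [gaussTail]
  linarith

lemma gaussTail_sqrt_le {x : ℝ} (hx : 0 ≤ x) :
    gaussTail (Real.sqrt x) ≤ Real.exp (-(Real.pi * x)) := by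
  have := gaussTail_le (Real.sqrt_nonneg x)
  rwa [Real.sq_sqrt hx, neg_mul] at this

lemma hasDerivAt_gaussInt_sqrt_mul {t u : ℝ} (ht : 0 < t) (hu : 0 < u) :
    HasDerivAt (fun u => gaussInt (Real.sqrt t * Real.sqrt u))
      (Real.sqrt t * (1 / (2 * Real.sqrt u) * Real.exp (-(Real.pi * u * t)))) u := by
  have h1 := ((Real.hasDerivAt_sqrt hu.ne').const_mul (Real.sqrt t))
  have h2 := (hasDerivAt_gaussInt (Real.sqrt t * Real.sqrt u)).comp u h1
  convert! h2 using 1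
  rw [mul_pow, Real.sq_sqrt ht.le, Real.sq_sqrt hu.le,
    show -Real.pi * (t * u) = -(Real.pi * u * t) by ring]
  ring

/-- An integral representation of the Gaussian tail. -/
lemma sqrt_mul_integral_eq_gaussTail {t : ℝ} (ht : 0 < t) :
    Real.sqrt t * ∫ u in Ioi (1 : ℝ), 1 / (2 * Real.sqrt u) * Real.exp (-(Real.pi * u * t)) =
      gaussTail (Real.sqrt t) := by
  rw [← integral_const_mul]
  have h := integral_Ioi_of_hasDerivAt_of_nonneg' (a := 1)
    (fun u hu => hasDerivAt_gaussInt_sqrt_mul ht (lt_of_lt_of_le one_pos hu))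
    (fun u _ => by positivity)
    (tendsto_gaussInt.comp (Real.tendsto_sqrt_atTop.const_mul_atTop (Real.sqrt_pos.mpr ht)))
  rw [h, gaussTail, Real.sqrt_one, mul_one]

end GaussInt

/-! ### The Mellin transform of a Gaussian tail as a hypergeometric value. -/

section TailMellin

open Set Filter Topology

/-- The kernel whose two iterated integrals compare the Mellin transform of the Gaussian tail
with Euler's integral. -/
def tailKernel (s z : ℂ) (t u : ℝ) : ℂ :=
  (t : ℂ) ^ (s + 1 / 2 - 1) *
    (((1 / (2 * Real.sqrt u) : ℝ) : ℂ) * Complex.exp (-((Real.pi * (u - z)) * t)))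

lemma re_pi_mul_sub_pos {z : ℂ} (hz : z.re < 1) {u : ℝ} (hu : 1 < u) :
    0 < ((Real.pi : ℂ) * (u - z)).re := by
  rw [Complex.re_ofReal_mul]
  refine mul_pos Real.pi_pos ?_
  simp
  linarith

lemma re_add_half_pos {s : ℂ} (hs : 0 < s.re) : 0 < (s + 1 / 2).re := by
  have : (s + 1 / 2).re = s.re + 1 / 2 := by
    simp
  rw [this]
  linarith

/-- The t-integral is a Gamma integral with rate π(u - z); the condition Re z < 1 makes it converge
for all u > 1. Writing u - z = u(1 - z/u) and absorbing the factor 1/√u yields Euler's integrand. -/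
lemma integral_tailKernel_left {s z : ℂ} (hs : 0 < s.re) (hz : z.re < 1) {u : ℝ} (hu : 1 < u) :
    ∫ t in Ioi (0 : ℝ), tailKernel s z t u =
      Complex.Gamma (s + 1 / 2) * (Real.pi : ℂ) ^ (-(s + 1 / 2)) / 2 *
        ((u : ℂ) ^ (-s - 1) * (1 - z / u) ^ (-(s + 1 / 2))) := by
  have hu0 : 0 < u := lt_trans one_pos hu
  have huC : (u : ℂ) ≠ 0 := by exact_mod_cast hu0.ne'
  have h1 : ∫ t in Ioi (0 : ℝ), tailKernel s z t u = ((1 / (2 * Real.sqrt u) : ℝ) : ℂ) *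
      mellin (fun t : ℝ => Complex.exp (-((Real.pi * (u - z)) * t))) (s + 1 / 2) := by
    rw [mellin, ← integral_const_mul]
    refine setIntegral_congr_fun measurableSet_Ioi fun t _ => ?_
    simp only [tailKernel, smul_eq_mul]
    ring
  have hre : 0 < (u - z : ℂ).re := by
    simp
    linarith
  have hne : (u - z : ℂ) ≠ 0 := by
    intro h
    simp [h] at hre
  have hfac : (u - z : ℂ) = u * (1 - z / u) := by
    field_simp
  have hne' : (1 - z / u : ℂ) ≠ 0 := by
    intro h
    rw [hfac, h, mul_zero] at hne
    exact hne rfl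
  have hsqrt : ((Real.sqrt u : ℝ) : ℂ) = (u : ℂ) ^ (1 / 2 : ℂ) := by
    rw [Real.sqrt_eq_rpow, Complex.ofReal_cpow hu0.le]
    norm_num
  rw [h1, mellin_exp_neg_mul (re_add_half_pos hs) (re_pi_mul_sub_pos hz hu),
    ofReal_mul_cpow Real.pi_pos hne, hfac, ofReal_mul_cpow hu0 hne',
    show -s - 1 = -(s + 1 / 2) - 1 / 2 by ring, Complex.cpow_sub _ _ huC, ← hsqrt]
  push_cast
  ring

/-- The half power of t in the kernel is exactly the √t required by
`sqrt_mul_integral_eq_gaussTail`. -/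
lemma integral_tailKernel_right (s z : ℂ) {t : ℝ} (ht : 0 < t) :
    ∫ u in Ioi (1 : ℝ), tailKernel s z t u =
      (t : ℂ) ^ (s - 1) • ((gaussTail (Real.sqrt t) : ℂ) * Complex.exp (Real.pi * z * t)) := by
  have htC : (t : ℂ) ≠ 0 := by exact_mod_cast ht.ne'
  have h1 : ∀ u : ℝ, tailKernel s z t u = ((t : ℂ) ^ (s + 1 / 2 - 1) *
      Complex.exp (Real.pi * z * t)) *
        ((1 / (2 * Real.sqrt u) * Real.exp (-(Real.pi * u * t)) : ℝ) : ℂ) := by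
    intro u
    rw [tailKernel, show -((Real.pi * ((u : ℂ) - z)) * t) =
      Real.pi * z * t + ((-(Real.pi * u * t) : ℝ) : ℂ) by push_cast; ring, Complex.exp_add]
    push_cast
    ring
  have hsqrt : ((Real.sqrt t : ℝ) : ℂ) = (t : ℂ) ^ (1 / 2 : ℂ) := by
    rw [Real.sqrt_eq_rpow, Complex.ofReal_cpow ht.le]
    norm_num
  simp only [h1]
  rw [integral_const_mul, integral_complex_ofReal, ← sqrt_mul_integral_eq_gaussTail ht,
    show s + 1 / 2 - 1 = (s - 1) + 1 / 2 by ring, Complex.cpow_add _ _ htC, ← hsqrt, smul_eq_mul]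
  push_cast
  ring

/-- Taking norms replaces s and z by their real parts, so absolute integrability for Fubini follows
from the inner integral already computed, at real parameters. -/
lemma tailKernel_eq_norm (s z : ℂ) {t : ℝ} (ht : 0 < t) (u : ℝ) :
    tailKernel s.re z.re t u = (‖tailKernel s z t u‖ : ℂ) := by
  rw [tailKernel, tailKernel, norm_mul, norm_mul, norm_exp_neg_mul_ofReal,
    Complex.norm_cpow_eq_rpow_re_of_pos ht, Complex.norm_real, Real.norm_of_nonneg (by positivity)]
  push_cast [Complex.ofReal_cpow ht.le, Complex.re_ofReal_mul]
  simp

lemma aestronglyMeasurable_tailKernel (s z : ℂ) :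
    AEStronglyMeasurable (Function.uncurry (tailKernel s z))
      ((volume.restrict (Ioi 0)).prod (volume.restrict (Ioi 1))) := by
  rw [Measure.prod_restrict]
  refine ContinuousOn.aestronglyMeasurable ?_ (measurableSet_Ioi.prod measurableSet_Ioi)
  rintro ⟨t, u⟩ ⟨ht, hu⟩
  have ht0 : (0 : ℝ) < t := ht
  have hu0 : (0 : ℝ) < u := lt_trans one_pos hu
  refine ContinuousAt.continuousWithinAt ?_
  refine ContinuousAt.mul ?_ (ContinuousAt.mul ?_ (by fun_prop))
  · exact ContinuousAt.comp (f := Prod.fst) (x := (t, u))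
      (g := fun t : ℝ => (t : ℂ) ^ (s + 1 / 2 - 1))
      (Complex.continuousAt_ofReal_cpow_const t _ (Or.inr ht0.ne')) continuousAt_fst
  · refine Complex.continuous_ofReal.continuousAt.comp (continuousAt_const.div (by fun_prop) ?_)
    have := Real.sqrt_pos.mpr hu0
    positivity

lemma integrable_tailKernel {s z : ℂ} (hs : 0 < s.re) (hz : z.re < 1) :
    Integrable (Function.uncurry (tailKernel s z))
      ((volume.restrict (Ioi 0)).prod (volume.restrict (Ioi 1))) := by
  rw [integrable_prod_iff' (aestronglyMeasurable_tailKernel s z)]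
  constructor
  · refine (ae_restrict_mem measurableSet_Ioi).mono fun u hu => ?_
    have := (mellinConvergent_exp_neg_mul (re_add_half_pos hs) (re_pi_mul_sub_pos hz hu)).const_mul
      (((1 / (2 * Real.sqrt u) : ℝ) : ℂ))
    refine this.congr (Eventually.of_forall fun t => ?_)
    simp only [tailKernel, Function.uncurry, smul_eq_mul]
    ring
  · have hz1 : 1 - (z.re : ℂ) ∈ Complex.slitPlane := Or.inl (by simpa using hz)
    have hs' : 0 < (s.re : ℂ).re := by simpa using hs
    have h1 := ((integrableOn_eulerIntegrand ((s.re : ℂ) + 1 / 2) hs' hz1).const_mul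
      (Complex.Gamma ((s.re : ℂ) + 1 / 2) * (Real.pi : ℂ) ^ (-((s.re : ℂ) + 1 / 2)) / 2)).norm
    refine Integrable.congr h1 ((ae_restrict_mem measurableSet_Ioi).mono fun u hu => ?_)
    have h2 : ∫ t in Ioi (0 : ℝ), tailKernel s.re z.re t u =
        ((∫ t in Ioi (0 : ℝ), ‖tailKernel s z t u‖ : ℝ) : ℂ) := by
      rw [← integral_complex_ofReal]
      exact setIntegral_congr_fun measurableSet_Ioi fun t ht => tailKernel_eq_norm s z ht u
    simp only [Function.uncurry]
    rw [← integral_tailKernel_left hs' (by simpa using hz) hu, h2, Complex.norm_real,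
      Real.norm_of_nonneg (integral_nonneg fun _ => norm_nonneg _)]

/-- The Mellin transform of a Gaussian tail times an exponential, in terms of Euler's integral. -/
lemma mellin_gaussTail_sqrt_mul_exp {s z : ℂ} (hs : 0 < s.re) (hz : z.re < 1) :
    mellin (fun t : ℝ => (gaussTail (Real.sqrt t) : ℂ) * Complex.exp (Real.pi * z * t)) s =
      Complex.Gamma (s + 1 / 2) * (Real.pi : ℂ) ^ (-(s + 1 / 2)) / (2 * s) *
        eulerInt (s + 1 / 2) s z := by
  have hs0 : s ≠ 0 := by
    rintro rfl
    simp at hs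
  calc mellin (fun t : ℝ => (gaussTail (Real.sqrt t) : ℂ) * Complex.exp (Real.pi * z * t)) s
      = ∫ t in Ioi (0 : ℝ), ∫ u in Ioi (1 : ℝ), tailKernel s z t u :=
        setIntegral_congr_fun measurableSet_Ioi fun t ht => (integral_tailKernel_right s z ht).symm
    _ = ∫ u in Ioi (1 : ℝ), ∫ t in Ioi (0 : ℝ), tailKernel s z t u :=
        integral_integral_swap (integrable_tailKernel hs hz)
    _ = ∫ u in Ioi (1 : ℝ), Complex.Gamma (s + 1 / 2) * (Real.pi : ℂ) ^ (-(s + 1 / 2)) / 2 *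
        ((u : ℂ) ^ (-s - 1) * (1 - z / u) ^ (-(s + 1 / 2))) :=
        setIntegral_congr_fun measurableSet_Ioi fun u hu => integral_tailKernel_left hs hz hu
    _ = _ := by
        rw [integral_const_mul, eulerInt]
        field_simp

/-- The Mellin transform of `t ↦ G(√(Xt)) exp(-πQt)`, with `G` the Gaussian tail. -/
lemma mellin_gaussTail_mul_exp {s Q : ℂ} {X : ℝ} (hs : 0 < s.re) (hX : 0 < X)
    (hXQ : 0 < X + Q.re) :
    mellin (fun t : ℝ => (gaussTail (Real.sqrt (X * t)) : ℂ) *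
        Complex.exp (-((Real.pi * Q) * t))) s =
      Complex.Gamma (s + 1 / 2) * (Real.pi : ℂ) ^ (-(s + 1 / 2)) / (2 * s) *
        ((X : ℂ) ^ (-s) * hyp2F1 s (s + 1 / 2) (s + 1) (-Q / X)) := by
  have hXC : (X : ℂ) ≠ 0 := by exact_mod_cast hX.ne'
  have hre : (-Q / (X : ℂ)).re < 1 := by
    rw [Complex.div_ofReal_re, Complex.neg_re, div_lt_one hX]
    linarith
  have hslit : 1 - -Q / (X : ℂ) ∈ Complex.slitPlane := Or.inl (by
    rw [Complex.sub_re, Complex.one_re]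
    linarith)
  -- Rescaling t by X reduces to X = 1 with z = -Q/X and produces the factor X^(-s).
  rw [hyp2F1_symm, hyp2F1_eq_eulerInt _ hs hslit, mul_left_comm,
    ← mellin_gaussTail_sqrt_mul_exp hs hre, ← smul_eq_mul ((X : ℂ) ^ (-s)),
    ← mellin_comp_mul_left _ _ hX]
  congr 1
  ext t
  rw [Complex.ofReal_mul]
  congr 2
  field_simp

end TailMellin

/-! ### Invariance of the correction summands under P. -/

section Stability

lemma e_add (z w : ℂ) : e (z + w) = e z * e w := by
  rw [e, e, e, ← Complex.exp_add]
  ring_nf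

lemma e_intCast (n : ℤ) : e n = 1 := by
  rw [e, show 2 * Real.pi * Complex.I * (n : ℂ) = n * (2 * Real.pi * Complex.I) by ring]
  exact Complex.exp_int_mul_two_pi_mul_I n

lemma norm_e_ofReal (x : ℝ) : ‖e x‖ = 1 := by
  rw [e, show 2 * Real.pi * Complex.I * (x : ℂ) = ((2 * Real.pi * x : ℝ) : ℂ) * Complex.I by
    push_cast; ring]
  exact Complex.norm_exp_ofReal_mul_I _

lemma dotProduct_toC (v w : Fin g → ℝ) : toC v ⬝ᵥ toC w = ((v ⬝ᵥ w : ℝ) : ℂ) := by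
  simp [toC, dotProduct]

lemma toC_mulVec (A : Matrix (Fin g) (Fin g) ℝ) (v : Fin g → ℝ) :
    toC (A *ᵥ v) = A.map ((↑) : ℝ → ℂ) *ᵥ toC v := by
  ext i
  simp [toC, mulVec, dotProduct]

lemma imPart_ofReal_mul (A : Matrix (Fin g) (Fin g) ℝ) (Ω : Matrix (Fin g) (Fin g) ℂ) :
    imPart (A.map ((↑) : ℝ → ℂ) * Ω) = A * imPart Ω := by
  ext i j
  simp [imPart, mul_apply]

lemma imPart_mul_ofReal (A : Matrix (Fin g) (Fin g) ℝ) (Ω : Matrix (Fin g) (Fin g) ℂ) :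
    imPart (Ω * A.map ((↑) : ℝ → ℂ)) = imPart Ω * A := by
  ext i j
  simp [imPart, mul_apply]

lemma im_mulVec_toC (Ω : Matrix (Fin g) (Fin g) ℂ) (v : Fin g → ℝ) :
    (fun i => ((Ω *ᵥ toC v) i).im) = imPart Ω *ᵥ v := by
  ext i
  simp [imPart, mulVec, dotProduct, toC]

lemma im_ofReal_mulVec (A : Matrix (Fin g) (Fin g) ℝ) (z : Fin g → ℂ) :
    (fun i => ((A.map ((↑) : ℝ → ℂ) *ᵥ z) i).im) = A *ᵥ fun i => (z i).im := by
  ext i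
  simp [mulVec, dotProduct]

lemma mulVec_dotProduct_mulVec_of_conj_eq {R : Type*} [CommRing R]
    {B Λ : Matrix (Fin g) (Fin g) R} (h : Bᵀ * Λ * B = Λ) (v w : Fin g → R) :
    (B *ᵥ v) ⬝ᵥ (Λ *ᵥ (B *ᵥ w)) = v ⬝ᵥ (Λ *ᵥ w) := by
  conv_rhs => rw [← h]
  rw [← mulVec_mulVec, ← mulVec_mulVec, dotProduct_mulVec v Bᵀ, vecMul_transpose]

/-- The permutation of `ℤ^g` given by an element of `GL_g(ℤ)`. -/
def latticeEquiv (P : GL (Fin g) ℤ) : (Fin g → ℤ) ≃ (Fin g → ℤ) where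
  toFun n := (P : Matrix (Fin g) (Fin g) ℤ) *ᵥ n
  invFun n := ((P⁻¹ : GL (Fin g) ℤ) : Matrix (Fin g) (Fin g) ℤ) *ᵥ n
  left_inv n := by
    dsimp only
    rw [mulVec_mulVec, ← Units.val_mul, inv_mul_cancel, Units.val_one, one_mulVec]
  right_inv n := by
    dsimp only
    rw [mulVec_mulVec, ← Units.val_mul, mul_inv_cancel, Units.val_one, one_mulVec]

/-- The real matrix underlying an element of `GL_g(ℤ)`. -/
def realMatrix (P : GL (Fin g) ℤ) : Matrix (Fin g) (Fin g) ℝ :=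
  (P : Matrix (Fin g) (Fin g) ℤ).map (Int.cast : ℤ → ℝ)

lemma map_ofReal_realMatrix (P : GL (Fin g) ℤ) :
    (realMatrix P).map ((↑) : ℝ → ℂ) = (P : Matrix (Fin g) (Fin g) ℤ).map (Int.cast : ℤ → ℂ) := by
  ext i j
  simp [realMatrix]

lemma realMatrix_mul_inv (P : GL (Fin g) ℤ) : realMatrix P * realMatrix P⁻¹ = 1 := by
  have h := congrArg (fun A : Matrix (Fin g) (Fin g) ℤ => A.map (Int.castRingHom ℝ))
    (show (P : Matrix (Fin g) (Fin g) ℤ) * (P⁻¹ : GL (Fin g) ℤ) = 1 by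
      rw [← Units.val_mul, mul_inv_cancel, Units.val_one])
  simp only [Matrix.map_mul, Matrix.map_one _ (map_zero _) (map_one _)] at h
  exact h

namespace IsPStable

variable {P : GL (Fin g) ℤ} {c₁ c₂ p q : Fin g → ℝ} {Ω : Matrix (Fin g) (Fin g) ℂ}

lemma conj_imPart {z : Fin g → ℂ} (h : IsPStable P c₁ c₂ z Ω) :
    (realMatrix P)ᵀ * imPart Ω * realMatrix P = imPart Ω := by
  have h1 := h.fix_form
  rw [← map_ofReal_realMatrix, ← transpose_map] at h1
  have h2 := congrArg imPart h1
  rwa [imPart_mul_ofReal, imPart_ofReal_mul] at h2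

/-- Imaginary parts of the fixed-point condition give PᵀMq = Mq, and Mq = PᵀMPq by invariance of M.
Both Pᵀ and M are injective, so they cancel. -/
lemma realMatrix_mulVec_char (h : IsPStable P c₁ c₂ (toC p + Ω *ᵥ toC q) Ω) :
    realMatrix P *ᵥ q = q := by
  obtain ⟨-, j, hj, hsig⟩ := h.mem
  obtain ⟨a, ha⟩ := h.fix_point
  rw [← map_ofReal_realMatrix, ← transpose_map] at ha
  have hz : (fun i => ((toC p + Ω *ᵥ toC q) i).im) = imPart Ω *ᵥ q := by
    rw [← im_mulVec_toC]
    ext i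
    simp [toC]
  have h1 : (realMatrix P)ᵀ *ᵥ (imPart Ω *ᵥ q) = imPart Ω *ᵥ q := by
    rw [← hz, ← im_ofReal_mulVec, ha]
    ext i
    simp
  have h2 : (realMatrix P)ᵀ *ᵥ (imPart Ω *ᵥ (realMatrix P *ᵥ q)) = imPart Ω *ᵥ q := by
    rw [mulVec_mulVec, mulVec_mulVec, h.conj_imPart]
  have h3 : (realMatrix P)ᵀ *ᵥ (imPart Ω *ᵥ (realMatrix P *ᵥ q - q)) = 0 := by
    rw [mulVec_sub, mulVec_sub, h2, h1, sub_self]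
  have h4 : imPart Ω *ᵥ (realMatrix P *ᵥ q - q) = 0 := by
    have := congrArg (fun v => (realMatrix P⁻¹)ᵀ *ᵥ v) h3
    simp only [mulVec_zero] at this
    rwa [mulVec_mulVec, ← transpose_mul, realMatrix_mul_inv, transpose_one, one_mulVec] at this
  exact sub_eq_zero.mp (hsig.mulVec_injective hj h.neg₁ h4)

/-- As ΩPq = Ωq, the Ω-part of the point is fixed by Pᵀ and the integral translation a falls on p
alone. Then aᵀq = pᵀPq - pᵀq = 0, which keeps the fractional part q from contributing to the
character. -/
lemma transpose_mulVec_toC (h : IsPStable P c₁ c₂ (toC p + Ω *ᵥ toC q) Ω) :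
    ∃ a : Fin g → ℤ, ((realMatrix P)ᵀ *ᵥ p) = p + (fun i => (a i : ℝ)) ∧
      (fun i => (a i : ℝ)) ⬝ᵥ q = 0 := by
  obtain ⟨a, ha⟩ := h.fix_point
  have hq := h.realMatrix_mulVec_char
  have hform := h.fix_form
  rw [← map_ofReal_realMatrix, ← transpose_map] at ha hform
  have h1 : (realMatrix P)ᵀ.map ((↑) : ℝ → ℂ) *ᵥ (Ω *ᵥ toC q) = Ω *ᵥ toC q := by
    conv_lhs => rw [← hq, toC_mulVec, mulVec_mulVec, mulVec_mulVec, hform]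
  rw [mulVec_add, h1, ← toC_mulVec] at ha
  have h2 : (realMatrix P)ᵀ *ᵥ p = p + fun i => (a i : ℝ) := by
    ext i
    have := congrFun ha i
    simp only [Pi.add_apply, toC] at this
    have h3 : ((((realMatrix P)ᵀ *ᵥ p) i : ℝ) : ℂ) = ((p i + (a i : ℝ) : ℝ) : ℂ) := by
      push_cast
      linear_combination this
    exact_mod_cast h3
  refine ⟨a, h2, ?_⟩
  have h4 : (fun i => (a i : ℝ)) = (realMatrix P)ᵀ *ᵥ p - p := by
    rw [h2]
    simp
  rw [h4, sub_dotProduct, mulVec_transpose, ← dotProduct_mulVec, hq, sub_self]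

lemma shift_latticeEquiv (h : IsPStable P c₁ c₂ (toC p + Ω *ᵥ toC q) Ω) (n : Fin g → ℤ) :
    shift q (latticeEquiv P n) = realMatrix P *ᵥ shift q n := by
  have h1 : ∀ n : Fin g → ℤ, shift q n = (fun i => (n i : ℝ)) + q := fun n => rfl
  rw [h1, h1, mulVec_add, h.realMatrix_mulVec_char]
  congr 1
  ext i
  simp [latticeEquiv, realMatrix, mulVec, dotProduct]

lemma e_dotProduct_shift_latticeEquiv (h : IsPStable P c₁ c₂ (toC p + Ω *ᵥ toC q) Ω)
    (n : Fin g → ℤ) :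
    e (toC p ⬝ᵥ toC (shift q (latticeEquiv P n))) = e (toC p ⬝ᵥ toC (shift q n)) := by
  obtain ⟨a, ha, haq⟩ := h.transpose_mulVec_toC
  have h1 : shift q n = (fun i => (n i : ℝ)) + q := rfl
  have h2 : p ⬝ᵥ shift q (latticeEquiv P n) = p ⬝ᵥ shift q n + ((a ⬝ᵥ n : ℤ) : ℝ) := by
    rw [h.shift_latticeEquiv, dotProduct_mulVec, ← mulVec_transpose, ha, add_dotProduct]
    congr 1
    rw [h1, dotProduct_add, haq, add_zero]
    simp [dotProduct]
  rw [dotProduct_toC, dotProduct_toC, h2, Complex.ofReal_add, e_add, Complex.ofReal_intCast,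
    e_intCast, mul_one]

/-- Each ingredient of the summand is a pairing through Ω or M, preserved when P acts on both
entries, or the character e(pᵀm), which is also invariant. -/
lemma xiTerm_latticeEquiv (h : IsPStable P c₁ c₂ (toC p + Ω *ᵥ toC q) Ω) (s : ℂ)
    (n : Fin g → ℤ) : xiTerm c₂ p q Ω s (latticeEquiv P n) = xiTerm c₁ p q Ω s n := by
  have hc : realMatrix P *ᵥ c₁ = c₂ := h.map_cone
  have h1 : c₂ ⬝ᵥ (imPart Ω *ᵥ shift q (latticeEquiv P n)) = c₁ ⬝ᵥ (imPart Ω *ᵥ shift q n) := by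
    rw [h.shift_latticeEquiv, ← hc, mulVec_dotProduct_mulVec_of_conj_eq h.conj_imPart]
  have h2 : qf (imPart Ω) c₂ = qf (imPart Ω) c₁ := by
    rw [qf, ← hc, mulVec_dotProduct_mulVec_of_conj_eq h.conj_imPart, qf]
  have hform := h.fix_form
  rw [← map_ofReal_realMatrix] at hform
  have h3 : qf (-Complex.I • Ω) (toC (shift q (latticeEquiv P n))) =
      qf (-Complex.I • Ω) (toC (shift q n)) := by
    rw [qf, h.shift_latticeEquiv, toC_mulVec, mulVec_dotProduct_mulVec_of_conj_eq, qf]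
    rw [mul_smul_comm, smul_mul_assoc, hform]
  rw [xiTerm, xiTerm, h1, h2, h3, h.e_dotProduct_shift_latticeEquiv]

end IsPStable

end Stability

/-! ### Exchanging Mellin transform and lattice sum. -/

section TermwiseMellin

open Set Filter Topology

/-- Raise y ≤ exp(y), at y = x/σ, to the power -σ. This trades Gaussian decay for the power that the
Epstein series can sum. -/
lemma exp_neg_le_div_rpow {σ x : ℝ} (hσ : 0 < σ) (hx : 0 < x) :
    Real.exp (-x) ≤ (x / σ) ^ (-σ) := by
  have h1 : x / σ ≤ Real.exp (x / σ) := by linarith [Real.add_one_le_exp (x / σ)]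
  have h2 := Real.rpow_le_rpow_of_nonpos (by positivity) h1 (neg_nonpos.mpr hσ.le)
  rw [← Real.exp_mul] at h2
  convert! h2 using 2
  field_simp

lemma mul_norm_sq_rpow_neg {E : Type*} [NormedAddCommGroup E] {b : ℝ} (hb : 0 < b) (σ : ℝ)
    (v : E) : (b * ‖v‖ ^ 2) ^ (-σ) = b ^ (-σ) * ‖v‖ ^ (-(2 * σ)) := by
  rw [Real.mul_rpow hb.le (sq_nonneg _), ← Real.rpow_natCast, ← Real.rpow_mul (norm_nonneg _)]
  congr 2
  push_cast
  ring

/-- Integrability of the sum is needed for `MellinConvergent`, separately from the value of its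
integral. Measurability comes from pointwise limits of finite sums, finiteness from Tonelli. -/
lemma integrable_tsum_of_summable_integral_norm {α ι : Type*} [Countable ι] [MeasurableSpace α]
    {μ : Measure α} {F : ι → α → ℂ} (hF : ∀ i, Integrable (F i) μ)
    (hsum : Summable fun i => ∫ a, ‖F i a‖ ∂μ) (hpt : ∀ᵐ a ∂μ, Summable fun i => F i a) :
    Integrable (fun a => ∑' i, F i a) μ := by
  refine ⟨?_, ?_⟩
  · refine aestronglyMeasurable_of_tendsto_ae (atTop : Filter (Finset ι))
      (f := fun s a => ∑ i ∈ s, F i a) (fun s => ?_) ?_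
    · exact Finset.aestronglyMeasurable_fun_sum s fun i _ => (hF i).1
    · filter_upwards [hpt] with a ha using ha.hasSum
  · refine lt_of_le_of_lt (lintegral_mono fun a => enorm_tsum_le_tsum_enorm) ?_
    rw [lintegral_tsum fun i => (hF i).1.enorm]
    have h1 : ∀ i, ∫⁻ a, ‖F i a‖ₑ ∂μ = ENNReal.ofReal (∫ a, ‖F i a‖ ∂μ) := fun i =>
      (ofReal_integral_norm_eq_lintegral_enorm (hF i)).symm
    simp only [h1]
    exact hsum.tsum_ofReal_lt_top

/-- Termwise Mellin transform of a series over a shifted lattice whose terms are dominated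
by Gaussians. -/
lemma hasSum_mellin_of_norm_le_exp {q : Fin g → ℝ} {f : (Fin g → ℤ) → ℝ → ℂ} {C δ : ℝ} {s : ℂ}
    (hs : (g : ℝ) / 2 < s.re) (hδ : 0 < δ) (hC : 0 ≤ C) (hcont : ∀ n, Continuous (f n))
    (hzero : ∀ n, shift q n = 0 → f n = 0)
    (hle : ∀ n t, 0 < t → ‖f n t‖ ≤ C * Real.exp (-(δ * ‖shift q n‖ ^ 2 * t))) :
    (∀ t, 0 < t → Summable fun n => f n t) ∧ MellinConvergent (fun t => ∑' n, f n t) s ∧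
      HasSum (fun n => mellin (f n) s) (mellin (fun t => ∑' n, f n t) s) := by
  have hσ : 0 < s.re := lt_of_le_of_lt (by positivity) hs
  -- The Mellin transform of exp(-δ‖m‖²t) scales as ‖m‖^(-2s), so Re s > g/2 is exactly the Epstein
  -- convergence condition.
  have hlat : Summable fun n : Fin g → ℤ => ‖shift q n‖ ^ (-(2 * s.re)) :=
    summable_norm_shift_rpow q (by linarith)
  have hpt : ∀ t, 0 < t → Summable fun n => f n t := by
    intro t ht
    refine Summable.of_norm_bounded (hlat.mul_left (C * (δ * t / s.re) ^ (-s.re))) fun n => ?_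
    by_cases hn : shift q n = 0
    · rw [hzero n hn, Pi.zero_apply, norm_zero]
      positivity
    · have hpos : 0 < ‖shift q n‖ := norm_pos_iff.mpr hn
      refine (hle n t ht).trans ?_
      have h1 := exp_neg_le_div_rpow hσ (show 0 < δ * ‖shift q n‖ ^ 2 * t by positivity)
      rw [show δ * ‖shift q n‖ ^ 2 * t / s.re = δ * t / s.re * ‖shift q n‖ ^ 2 by ring,
        mul_norm_sq_rpow_neg (by positivity)] at h1
      calc C * Real.exp (-(δ * ‖shift q n‖ ^ 2 * t))
          ≤ C * ((δ * t / s.re) ^ (-s.re) * ‖shift q n‖ ^ (-(2 * s.re))) := by gcongr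
        _ = _ := by ring
  have hint : ∀ n, MellinConvergent (f n) s := by
    intro n
    -- At m = 0 the bound is a constant, without decay; the vanishing of the summand there is
    -- indispensable.
    by_cases hn : shift q n = 0
    · rw [hzero n hn]
      simp [MellinConvergent]
    · have hpos : 0 < ‖shift q n‖ := norm_pos_iff.mpr hn
      exact mellinConvergent_of_norm_le_exp hσ (show 0 < δ * ‖shift q n‖ ^ 2 by positivity)
        (hcont n).continuousOn (hle n)
  have hsum : Summable fun n => ∫ t in Ioi (0 : ℝ), ‖(t : ℂ) ^ (s - 1) • f n t‖ := by
    refine Summable.of_nonneg_of_le (fun n => integral_nonneg fun _ => norm_nonneg _) (fun n => ?_)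
      (hlat.mul_left (C * Real.Gamma s.re * δ ^ (-s.re)))
    by_cases hn : shift q n = 0
    · rw [hzero n hn]
      simp only [Pi.zero_apply, smul_zero, norm_zero, integral_zero]
      have := (Real.Gamma_pos_of_pos hσ).le
      positivity
    · have hpos : 0 < ‖shift q n‖ := norm_pos_iff.mpr hn
      have hb : 0 < δ * ‖shift q n‖ ^ 2 := by positivity
      calc ∫ t in Ioi (0 : ℝ), ‖(t : ℂ) ^ (s - 1) • f n t‖
          ≤ ∫ t in Ioi (0 : ℝ), C * (t ^ (s.re - 1) *
              Real.exp (-(δ * ‖shift q n‖ ^ 2 * t))) := by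
            refine setIntegral_mono_on (hint n).norm ((integrableOn_rpow_mul_exp hσ hb).const_mul C)
              measurableSet_Ioi fun t ht => ?_
            have ht0 : (0 : ℝ) < t := ht
            rw [norm_smul, Complex.norm_cpow_eq_rpow_re_of_pos ht0, Complex.sub_re, Complex.one_re]
            calc t ^ (s.re - 1) * ‖f n t‖
                ≤ t ^ (s.re - 1) * (C * Real.exp (-(δ * ‖shift q n‖ ^ 2 * t))) := by
                  gcongr
                  exact hle n t ht0
              _ = _ := by ring
        _ = C * Real.Gamma s.re * (δ * ‖shift q n‖ ^ 2) ^ (-s.re) := by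
            rw [integral_const_mul, Real.integral_rpow_mul_exp_neg_mul_Ioi hσ hb, one_div,
              Real.inv_rpow hb.le, Real.rpow_neg hb.le]
            ring
        _ = _ := by
            rw [mul_norm_sq_rpow_neg hδ]
            ring
  have htsum : ∀ t : ℝ, ∑' n, (t : ℂ) ^ (s - 1) • f n t = (t : ℂ) ^ (s - 1) • ∑' n, f n t :=
    fun t => by
      simp only [smul_eq_mul]
      exact tsum_mul_left
  refine ⟨hpt, ?_, ?_⟩
  · have h1 := integrable_tsum_of_summable_integral_norm (μ := volume.restrict (Ioi (0 : ℝ)))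
      (F := fun n t => (t : ℂ) ^ (s - 1) • f n t) hint hsum
      ((ae_restrict_mem measurableSet_Ioi).mono fun t ht => (hpt t ht).const_smul _)
    simp only [htsum] at h1
    exact h1
  · have h1 := hasSum_integral_of_summable_integral_norm (μ := volume.restrict (Ioi (0 : ℝ)))
      (F := fun n t => (t : ℂ) ^ (s - 1) • f n t) hint hsum
    simp only [htsum] at h1
    exact h1

end TermwiseMellin

/-! ### Decomposition of the theta series and its Mellin transform. -/

section Series

open Set Filter Topology

lemma norm_real_sign_le_one (x : ℝ) : ‖(Real.sign x : ℂ)‖ ≤ 1 := by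
  rcases Real.sign_apply_eq x with h | h | h <;> simp [h]

lemma re_qf_neg_I_smul (Ω : Matrix (Fin g) (Fin g) ℂ) (v : Fin g → ℝ) :
    (qf (-Complex.I • Ω) (toC v)).re = qf (imPart Ω) v := by
  simp [qf, imPart, mulVec, dotProduct, toC, Finset.mul_sum]

lemma qf_smul_matrix {R : Type*} [CommRing R] (a : R) (A : Matrix (Fin g) (Fin g) R)
    (v : Fin g → R) : qf (a • A) v = a * qf A v := by
  simp [qf, smul_mulVec]

/-- The quantity `(cᵀMm)² / (-½ cᵀMc)` at `m = n + q`. -/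
def coneSq (c q : Fin g → ℝ) (Ω : Matrix (Fin g) (Fin g) ℂ) (n : Fin g → ℤ) : ℝ :=
  (c ⬝ᵥ (imPart Ω *ᵥ shift q n)) ^ 2 / (-(1 / 2) * qf (imPart Ω) c)

/-- The summand of the Gaussian tail part of the theta series along the ray `tΩ`. -/
def tailTerm (c p q : Fin g → ℝ) (Ω : Matrix (Fin g) (Fin g) ℂ) (n : Fin g → ℤ) (t : ℝ) : ℂ :=
  (Real.sign (c ⬝ᵥ (imPart Ω *ᵥ shift q n)) : ℂ) * e (toC p ⬝ᵥ toC (shift q n)) *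
    ((gaussTail (Real.sqrt (coneSq c q Ω n * t)) : ℂ) *
      Complex.exp (-((Real.pi * qf (-Complex.I • Ω) (toC (shift q n))) * t)))

/-- The summand of the sign part of the theta series along the ray `tΩ`. -/
def signTerm (c₁ c₂ p q : Fin g → ℝ) (Ω : Matrix (Fin g) (Fin g) ℂ) (n : Fin g → ℤ) (t : ℝ) : ℂ :=
  1 / 2 * ((Real.sign (c₂ ⬝ᵥ (imPart Ω *ᵥ shift q n)) -
      Real.sign (c₁ ⬝ᵥ (imPart Ω *ᵥ shift q n)) : ℝ) : ℂ) * e (toC p ⬝ᵥ toC (shift q n)) *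
    Complex.exp (-((Real.pi * qf (-Complex.I • Ω) (toC (shift q n))) * t))

variable {c c₁ c₂ p q : Fin g → ℝ} {Ω : Matrix (Fin g) (Fin g) ℂ} {s : ℂ}

lemma norm_e_char (p v : Fin g → ℝ) : ‖e (toC p ⬝ᵥ toC v)‖ = 1 := by
  rw [dotProduct_toC]
  exact norm_e_ofReal _

lemma coneSq_nonneg (hc : qf (imPart Ω) c < 0) (n : Fin g → ℤ) : 0 ≤ coneSq c q Ω n :=
  div_nonneg (sq_nonneg _) (by linarith)

/-- The tail contributes exp(-πXt) with X = `coneSq`, which compensates possible growth of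
exp(-πQt): the total exponent is governed by the positive definite majorant. -/
lemma norm_tailTerm_le (hc : qf (imPart Ω) c < 0) {δ : ℝ} (hδ : ∀ v, δ * ‖v‖ ^ 2 ≤
      qf (imPart Ω) v + (c ⬝ᵥ (imPart Ω *ᵥ v)) ^ 2 / (-(1 / 2) * qf (imPart Ω) c))
    (n : Fin g → ℤ) {t : ℝ} (ht : 0 < t) :
    ‖tailTerm c p q Ω n t‖ ≤ 1 * Real.exp (-(Real.pi * δ * ‖shift q n‖ ^ 2 * t)) := by
  have hX : 0 ≤ coneSq c q Ω n * t := mul_nonneg (coneSq_nonneg hc n) ht.le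
  rw [tailTerm, norm_mul, norm_mul, norm_mul, norm_e_char, mul_one,
    Complex.norm_real (gaussTail _),
    Real.norm_of_nonneg (gaussTail_nonneg _), norm_exp_neg_mul_ofReal, Complex.re_ofReal_mul,
    re_qf_neg_I_smul]
  refine mul_le_mul (norm_real_sign_le_one _) ?_
    (mul_nonneg (gaussTail_nonneg _) (Real.exp_pos _).le) zero_le_one
  calc gaussTail (Real.sqrt (coneSq c q Ω n * t)) *
        Real.exp (-(Real.pi * qf (imPart Ω) (shift q n) * t))
      ≤ Real.exp (-(Real.pi * (coneSq c q Ω n * t))) *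
        Real.exp (-(Real.pi * qf (imPart Ω) (shift q n) * t)) := by
        gcongr
        exact gaussTail_sqrt_le hX
    _ ≤ _ := by
        rw [← Real.exp_add]
        refine Real.exp_le_exp.mpr ?_
        have h1 := mul_le_mul_of_nonneg_left (hδ (shift q n))
          (mul_nonneg Real.pi_pos.le ht.le)
        rw [← coneSq] at h1
        linarith

lemma continuous_tailTerm (n : Fin g → ℤ) : Continuous (tailTerm c p q Ω n) := by
  unfold tailTerm
  have := continuous_gaussTail
  fun_prop

lemma tailTerm_eq_zero {n : Fin g → ℤ} (h : c ⬝ᵥ (imPart Ω *ᵥ shift q n) = 0) :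
    tailTerm c p q Ω n = 0 := by
  ext t
  simp [tailTerm, h]

lemma mellin_tailTerm {j : ℕ} (hj : j + 1 = g) (hsig : HasSignature (imPart Ω) j 1)
    (hc : qf (imPart Ω) c < 0) (hs : 0 < s.re) (n : Fin g → ℤ) :
    mellin (tailTerm c p q Ω n) s =
      Complex.Gamma (s + 1 / 2) * (Real.pi : ℂ) ^ (-(s + 1 / 2)) / (2 * s) *
        xiTerm c p q Ω s n := by
  by_cases h0 : c ⬝ᵥ (imPart Ω *ᵥ shift q n) = 0
  · rw [tailTerm_eq_zero h0]
    simp [xiTerm, h0, mellin]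
  have hm : shift q n ≠ 0 := by
    intro h
    simp [h] at h0
  have hX : 0 < coneSq c q Ω n := div_pos (by positivity) (by linarith)
  have hXQ : 0 < coneSq c q Ω n + (qf (-Complex.I • Ω) (toC (shift q n))).re := by
    rw [re_qf_neg_I_smul, add_comm]
    exact hsig.majorant_pos hj hc hm
  have h1 := mellin_const_smul (fun t : ℝ => (gaussTail (Real.sqrt (coneSq c q Ω n * t)) : ℂ) *
      Complex.exp (-((Real.pi * qf (-Complex.I • Ω) (toC (shift q n))) * t))) s
    ((Real.sign (c ⬝ᵥ (imPart Ω *ᵥ shift q n)) : ℂ) * e (toC p ⬝ᵥ toC (shift q n)))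
  simp only [smul_eq_mul] at h1
  have h2 : -qf (-Complex.I • Ω) (toC (shift q n)) / (coneSq c q Ω n : ℂ) =
      ((qf (imPart Ω) c : ℝ) : ℂ) * qf (-Complex.I • Ω) (toC (shift q n)) /
        (2 * ((c ⬝ᵥ (imPart Ω *ᵥ shift q n) : ℝ) : ℂ) ^ 2) := by
    have h3 : ((c ⬝ᵥ (imPart Ω *ᵥ shift q n) : ℝ) : ℂ) ≠ 0 := by exact_mod_cast h0
    have h4 : ((qf (imPart Ω) c : ℝ) : ℂ) ≠ 0 := by exact_mod_cast hc.ne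
    rw [coneSq]
    push_cast
    field_simp
  unfold tailTerm
  rw [h1, mellin_gaussTail_mul_exp hs hX hXQ, xiTerm, ← coneSq, h2]
  ring

lemma continuous_signTerm (n : Fin g → ℤ) : Continuous (signTerm c₁ c₂ p q Ω n) := by
  unfold signTerm
  fun_prop

lemma mul_nonpos_of_sign_ne {a b : ℝ} (h : Real.sign a ≠ Real.sign b) : b * a ≤ 0 := by
  by_contra! hlt
  rcases pos_and_pos_or_neg_and_neg_of_mul_pos hlt with ⟨hb, ha⟩ | ⟨hb, ha⟩
  · exact h (by rw [Real.sign_of_pos ha, Real.sign_of_pos hb])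
  · exact h (by rw [Real.sign_of_neg ha, Real.sign_of_neg hb])

lemma signTerm_eq_zero {n : Fin g → ℤ} (h : Real.sign (c₂ ⬝ᵥ (imPart Ω *ᵥ shift q n)) =
    Real.sign (c₁ ⬝ᵥ (imPart Ω *ᵥ shift q n))) : signTerm c₁ c₂ p q Ω n = 0 := by
  ext t
  simp [signTerm, h]

lemma norm_signTerm_le {δ : ℝ} (hδ : ∀ v, (c₁ ⬝ᵥ (imPart Ω *ᵥ v)) * (c₂ ⬝ᵥ (imPart Ω *ᵥ v)) ≤ 0 →
      δ * ‖v‖ ^ 2 ≤ qf (imPart Ω) v) (n : Fin g → ℤ) {t : ℝ} (ht : 0 < t) :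
    ‖signTerm c₁ c₂ p q Ω n t‖ ≤ 1 * Real.exp (-(Real.pi * δ * ‖shift q n‖ ^ 2 * t)) := by
  by_cases h : Real.sign (c₂ ⬝ᵥ (imPart Ω *ᵥ shift q n)) =
    Real.sign (c₁ ⬝ᵥ (imPart Ω *ᵥ shift q n))
  · rw [signTerm_eq_zero h, Pi.zero_apply, norm_zero]
    positivity
  have h1 := mul_le_mul_of_nonneg_left (hδ (shift q n) (mul_nonpos_of_sign_ne h))
    (mul_nonneg Real.pi_pos.le ht.le)
  rw [signTerm, norm_mul, norm_mul, norm_e_char, mul_one, norm_exp_neg_mul_ofReal,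
    Complex.re_ofReal_mul, re_qf_neg_I_smul]
  refine mul_le_mul ?_ (Real.exp_le_exp.mpr (by linarith)) (Real.exp_pos _).le zero_le_one
  have h2 := norm_real_sign_le_one (c₂ ⬝ᵥ (imPart Ω *ᵥ shift q n))
  have h3 := norm_real_sign_le_one (c₁ ⬝ᵥ (imPart Ω *ᵥ shift q n))
  rw [norm_mul, Complex.ofReal_sub]
  have h4 := norm_sub_le (Real.sign (c₂ ⬝ᵥ (imPart Ω *ᵥ shift q n)) : ℂ)
    (Real.sign (c₁ ⬝ᵥ (imPart Ω *ᵥ shift q n)) : ℂ)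
  have h5 : ‖(1 / 2 : ℂ)‖ = 1 / 2 := by norm_num
  rw [h5]
  linarith

lemma mellin_signTerm {j : ℕ} (hj : j + 1 = g) (hsig : HasSignature (imPart Ω) j 1)
    (hc₁ : qf (imPart Ω) c₁ < 0) (hc₂ : qf (imPart Ω) c₂ < 0)
    (hc : c₁ ⬝ᵥ (imPart Ω *ᵥ c₂) < 0) (hs : 0 < s.re) (n : Fin g → ℤ) :
    mellin (signTerm c₁ c₂ p q Ω n) s =
      (Real.pi : ℂ) ^ (-s) * Complex.Gamma s * (1 / 2) * coneTerm c₁ c₂ p q Ω s n := by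
  by_cases h : Real.sign (c₂ ⬝ᵥ (imPart Ω *ᵥ shift q n)) =
    Real.sign (c₁ ⬝ᵥ (imPart Ω *ᵥ shift q n))
  · rw [signTerm_eq_zero h]
    simp [coneTerm, h, mellin]
  have hm : shift q n ≠ 0 := by
    intro h0
    simp [h0] at h
  have hQ : 0 < (qf (-Complex.I • Ω) (toC (shift q n))).re := by
    rw [re_qf_neg_I_smul]
    exact hsig.qf_pos_of_separating hj hc₁ hc₂ hc (mul_nonpos_of_sign_ne h) hm
  have hQ0 : qf (-Complex.I • Ω) (toC (shift q n)) ≠ 0 := by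
    intro h0
    rw [h0] at hQ
    simp at hQ
  have h1 := mellin_const_smul (fun t : ℝ =>
      Complex.exp (-((Real.pi * qf (-Complex.I • Ω) (toC (shift q n))) * t))) s
    (1 / 2 * ((Real.sign (c₂ ⬝ᵥ (imPart Ω *ᵥ shift q n)) -
      Real.sign (c₁ ⬝ᵥ (imPart Ω *ᵥ shift q n)) : ℝ) : ℂ) * e (toC p ⬝ᵥ toC (shift q n)))
  simp only [smul_eq_mul] at h1
  unfold signTerm
  rw [h1, mellin_exp_neg_mul hs (by rw [Complex.re_ofReal_mul]; exact mul_pos Real.pi_pos hQ),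
    ofReal_mul_cpow Real.pi_pos hQ0, coneTerm]
  ring

lemma imPart_ofReal_smul (t : ℝ) (Ω : Matrix (Fin g) (Fin g) ℂ) :
    imPart ((t : ℂ) • Ω) = t • imPart Ω := by
  ext i j
  simp [imPart]

/-- The numerator scales by t and the denominator by √t; the real vector p disappears from the
imaginary part. -/
lemma thetaArg_smul (c p q : Fin g → ℝ) (Ω : Matrix (Fin g) (Fin g) ℂ) {t : ℝ} (ht : 0 < t)
    (n : Fin g → ℤ) :
    thetaArg c (toC p + ((t : ℂ) • Ω) *ᵥ toC q) ((t : ℂ) • Ω) n =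
      Real.sqrt t * ((c ⬝ᵥ (imPart Ω *ᵥ shift q n)) /
        Real.sqrt (-(1 / 2) * qf (imPart Ω) c)) := by
  have hvec : (fun i => ((((t : ℂ) • Ω) *ᵥ (fun j => (n j : ℂ)) +
      (toC p + ((t : ℂ) • Ω) *ᵥ toC q)) i).im) = t • (imPart Ω *ᵥ shift q n) := by
    rw [← smul_mulVec, ← imPart_ofReal_smul, ← im_mulVec_toC]
    have : toC (shift q n) = (fun j => (n j : ℂ)) + toC q := by
      ext i
      simp [toC, shift]
    rw [this, mulVec_add]
    ext i
    simp [toC]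
  have ht' : t / Real.sqrt t = Real.sqrt t := Real.div_sqrt
  rw [thetaArg, hvec, imPart_ofReal_smul, qf_smul_matrix, dotProduct_smul, smul_eq_mul,
    show -(1 / 2) * (t * qf (imPart Ω) c) = t * (-(1 / 2) * qf (imPart Ω) c) by ring,
    Real.sqrt_mul ht.le, mul_div_mul_comm, ht']

lemma gaussInt_thetaArg_smul (hc : qf (imPart Ω) c < 0) {t : ℝ} (ht : 0 < t) (n : Fin g → ℤ) :
    gaussInt (thetaArg c (toC p + ((t : ℂ) • Ω) *ᵥ toC q) ((t : ℂ) • Ω) n) =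
      Real.sign (c ⬝ᵥ (imPart Ω *ᵥ shift q n)) *
        (1 / 2 - gaussTail (Real.sqrt (coneSq c q Ω n * t))) := by
  have hr : 0 < -(1 / 2) * qf (imPart Ω) c := by linarith
  have hr' := Real.sqrt_pos.mpr hr
  have hsign : Real.sign ((c ⬝ᵥ (imPart Ω *ᵥ shift q n)) /
      Real.sqrt (-(1 / 2) * qf (imPart Ω) c)) = Real.sign (c ⬝ᵥ (imPart Ω *ᵥ shift q n)) := by
    rcases lt_trichotomy (c ⬝ᵥ (imPart Ω *ᵥ shift q n)) 0 with h | h | h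
    · rw [Real.sign_of_neg h, Real.sign_of_neg (div_neg_of_neg_of_pos h hr')]
    · rw [h, zero_div]
    · rw [Real.sign_of_pos h, Real.sign_of_pos (div_pos h hr')]
  have hsqrt : Real.sqrt (coneSq c q Ω n * t) = Real.sqrt t *
      |(c ⬝ᵥ (imPart Ω *ᵥ shift q n)) / Real.sqrt (-(1 / 2) * qf (imPart Ω) c)| := by
    rw [mul_comm (coneSq c q Ω n), Real.sqrt_mul ht.le, coneSq, Real.sqrt_div (sq_nonneg _),
      Real.sqrt_sq_eq_abs, abs_div, abs_of_pos hr']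
  rw [thetaArg_smul c p q Ω ht, gaussInt_eq_sign_mul, hsign, hsqrt]

/-- The prefactor completes the square from n to m = n + q, and both `gaussInt` values split into
sign and tail. -/
lemma e_mul_thetaTerm_smul (hΩ : Ω.IsSymm) (hc₁ : qf (imPart Ω) c₁ < 0)
    (hc₂ : qf (imPart Ω) c₂ < 0) {t : ℝ} (ht : 0 < t) (n : Fin g → ℤ) :
    e (1 / 2 * qf ((t : ℂ) • Ω) (toC q) + toC p ⬝ᵥ toC q) *
        thetaTerm c₁ c₂ (toC p + ((t : ℂ) • Ω) *ᵥ toC q) ((t : ℂ) • Ω) n =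
      signTerm c₁ c₂ p q Ω n t - tailTerm c₂ p q Ω n t + tailTerm c₁ p q Ω n t := by
  have hshift : toC (shift q n) = (fun j => (n j : ℂ)) + toC q := by
    ext i
    simp [toC, shift]
  have hexp : e (1 / 2 * qf ((t : ℂ) • Ω) (toC q) + toC p ⬝ᵥ toC q) *
      e (1 / 2 * qf ((t : ℂ) • Ω) (fun i => (n i : ℂ)) +
        (fun i => (n i : ℂ)) ⬝ᵥ (toC p + ((t : ℂ) • Ω) *ᵥ toC q)) =
      e (toC p ⬝ᵥ toC (shift q n)) *
        Complex.exp (-((Real.pi * qf (-Complex.I • Ω) (toC (shift q n))) * t)) := by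
    have h1 : Complex.exp (-((Real.pi * qf (-Complex.I • Ω) (toC (shift q n))) * t)) =
        e (1 / 2 * qf ((t : ℂ) • Ω) (toC (shift q n))) := by
      rw [e, qf_smul_matrix, qf_smul_matrix]
      ring_nf
    rw [h1, ← e_add, ← e_add, hshift, qf_add (hΩ.smul (t : ℂ)), dotProduct_add, dotProduct_add,
      dotProduct_comm (toC p) fun i => (n i : ℂ)]
    ring_nf
  rw [thetaTerm, mul_left_comm, hexp, gaussInt_thetaArg_smul hc₁ ht, gaussInt_thetaArg_smul hc₂ ht,
    signTerm, tailTerm, tailTerm]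
  push_cast
  ring

lemma tailConst_ne_zero (hs : 0 < s.re) :
    Complex.Gamma (s + 1 / 2) * (Real.pi : ℂ) ^ (-(s + 1 / 2)) / (2 * s) ≠ 0 := by
  have hs0 : s ≠ 0 := by
    rintro rfl
    simp at hs
  have h1 := Complex.Gamma_ne_zero_of_re_pos (re_add_half_pos hs)
  have h2 : (Real.pi : ℂ) ^ (-(s + 1 / 2)) ≠ 0 := by
    simp [Complex.cpow_eq_zero_iff, Real.pi_ne_zero]
  exact div_ne_zero (mul_ne_zero h1 h2) (mul_ne_zero two_ne_zero hs0)

lemma tailTerm_series {j : ℕ} (hj : j + 1 = g) (hsig : HasSignature (imPart Ω) j 1)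
    (hc : qf (imPart Ω) c < 0) (hs : (g : ℝ) / 2 < s.re) :
    (∀ t, 0 < t → Summable fun n => tailTerm c p q Ω n t) ∧
      MellinConvergent (fun t => ∑' n, tailTerm c p q Ω n t) s ∧
      HasSum (fun n => mellin (tailTerm c p q Ω n) s)
        (mellin (fun t => ∑' n, tailTerm c p q Ω n t) s) := by
  obtain ⟨δ, hδ, hb⟩ := hsig.exists_majorant_bound hj hc
  refine hasSum_mellin_of_norm_le_exp hs (mul_pos Real.pi_pos hδ) zero_le_one continuous_tailTerm
    (fun n hn => tailTerm_eq_zero (by simp [hn])) fun n t ht => norm_tailTerm_le hc hb n ht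

lemma signTerm_series {j : ℕ} (hj : j + 1 = g) (hsig : HasSignature (imPart Ω) j 1)
    (hc₁ : qf (imPart Ω) c₁ < 0) (hc₂ : qf (imPart Ω) c₂ < 0)
    (hc : c₁ ⬝ᵥ (imPart Ω *ᵥ c₂) < 0) (hs : (g : ℝ) / 2 < s.re) :
    (∀ t, 0 < t → Summable fun n => signTerm c₁ c₂ p q Ω n t) ∧
      MellinConvergent (fun t => ∑' n, signTerm c₁ c₂ p q Ω n t) s ∧
      HasSum (fun n => mellin (signTerm c₁ c₂ p q Ω n) s)
        (mellin (fun t => ∑' n, signTerm c₁ c₂ p q Ω n t) s) := by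
  obtain ⟨δ, hδ, hb⟩ := hsig.exists_separating_bound hj hc₁ hc₂ hc
  refine hasSum_mellin_of_norm_le_exp hs (mul_pos Real.pi_pos hδ) zero_le_one continuous_signTerm
    (fun n hn => signTerm_eq_zero (by simp [hn])) fun n t ht => norm_signTerm_le hb n ht

/-- The Mellin transforms of the tail summands are summable and equal the summands of ξ up to a
nonzero constant, which can be divided out. -/
lemma summable_xiTerm {j : ℕ} (hj : j + 1 = g) (hsig : HasSignature (imPart Ω) j 1)
    (hc : qf (imPart Ω) c < 0) (hs : (g : ℝ) / 2 < s.re) : Summable (xiTerm c p q Ω s) := by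
  have hσ : 0 < s.re := lt_of_le_of_lt (by positivity) hs
  have h := (tailTerm_series (p := p) (q := q) hj hsig hc hs).2.2.summable
  simp only [mellin_tailTerm hj hsig hc hσ] at h
  exact (summable_mul_left_iff (tailConst_ne_zero hσ)).mp h

lemma mellin_tsum_tailTerm {j : ℕ} (hj : j + 1 = g) (hsig : HasSignature (imPart Ω) j 1)
    (hc : qf (imPart Ω) c < 0) (hs : (g : ℝ) / 2 < s.re) :
    mellin (fun t => ∑' n, tailTerm c p q Ω n t) s =
      Complex.Gamma (s + 1 / 2) * (Real.pi : ℂ) ^ (-(s + 1 / 2)) * xi c p q Ω s := by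
  have hσ : 0 < s.re := lt_of_le_of_lt (by positivity) hs
  rw [← (tailTerm_series hj hsig hc hs).2.2.tsum_eq]
  simp only [mellin_tailTerm hj hsig hc hσ]
  rw [tsum_mul_left, xi]
  ring

lemma summable_coneTerm {j : ℕ} (hj : j + 1 = g) (hsig : HasSignature (imPart Ω) j 1)
    (hc₁ : qf (imPart Ω) c₁ < 0) (hc₂ : qf (imPart Ω) c₂ < 0)
    (hc : c₁ ⬝ᵥ (imPart Ω *ᵥ c₂) < 0) (hs : (g : ℝ) / 2 < s.re) :
    Summable (coneTerm c₁ c₂ p q Ω s) := by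
  have hσ : 0 < s.re := lt_of_le_of_lt (by positivity) hs
  have h := (signTerm_series (p := p) (q := q) hj hsig hc₁ hc₂ hc hs).2.2.summable
  simp only [mellin_signTerm hj hsig hc₁ hc₂ hc hσ] at h
  refine (summable_mul_left_iff ?_).mp h
  have h2 : (Real.pi : ℂ) ^ (-s) ≠ 0 := by
    simp [Complex.cpow_eq_zero_iff, Real.pi_ne_zero]
  exact mul_ne_zero (mul_ne_zero h2 (Complex.Gamma_ne_zero_of_re_pos hσ)) (by norm_num)

lemma mellin_tsum_signTerm {j : ℕ} (hj : j + 1 = g) (hsig : HasSignature (imPart Ω) j 1)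
    (hc₁ : qf (imPart Ω) c₁ < 0) (hc₂ : qf (imPart Ω) c₂ < 0)
    (hc : c₁ ⬝ᵥ (imPart Ω *ᵥ c₂) < 0) (hs : (g : ℝ) / 2 < s.re) :
    mellin (fun t => ∑' n, signTerm c₁ c₂ p q Ω n t) s =
      (Real.pi : ℂ) ^ (-s) * Complex.Gamma s * coneZeta c₁ c₂ p q Ω s := by
  have hσ : 0 < s.re := lt_of_le_of_lt (by positivity) hs
  rw [← (signTerm_series hj hsig hc₁ hc₂ hc hs).2.2.tsum_eq]
  simp only [mellin_signTerm hj hsig hc₁ hc₂ hc hσ]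
  rw [tsum_mul_left, coneZeta]
  ring

lemma summable_thetaTerm_smul {j : ℕ} (hj : j + 1 = g) (hsig : HasSignature (imPart Ω) j 1)
    (hΩ : Ω.IsSymm) (hc₁ : qf (imPart Ω) c₁ < 0) (hc₂ : qf (imPart Ω) c₂ < 0)
    (hc : c₁ ⬝ᵥ (imPart Ω *ᵥ c₂) < 0) {t : ℝ} (ht : 0 < t) :
    Summable (thetaTerm c₁ c₂ (toC p + ((t : ℂ) • Ω) *ᵥ toC q) ((t : ℂ) • Ω)) := by
  -- Pointwise convergence does not involve s; g/2 + 1 is merely one exponent admissible for the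
  -- Mellin lemmas.
  have hs : (g : ℝ) / 2 < (((g : ℝ) / 2 + 1 : ℝ) : ℂ).re := by
    rw [Complex.ofReal_re]
    linarith
  refine (summable_mul_left_iff (a := e (1 / 2 * qf ((t : ℂ) • Ω) (toC q) + toC p ⬝ᵥ toC q))
    (Complex.exp_ne_zero _)).mp ?_
  simp only [e_mul_thetaTerm_smul hΩ hc₁ hc₂ ht]
  exact (((signTerm_series hj hsig hc₁ hc₂ hc hs).1 t ht).sub
    ((tailTerm_series hj hsig hc₂ hs).1 t ht)).add ((tailTerm_series hj hsig hc₁ hs).1 t ht)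

lemma thetaRay_eq {j : ℕ} (hj : j + 1 = g) (hsig : HasSignature (imPart Ω) j 1)
    (hΩ : Ω.IsSymm) (hc₁ : qf (imPart Ω) c₁ < 0) (hc₂ : qf (imPart Ω) c₂ < 0)
    (hc : c₁ ⬝ᵥ (imPart Ω *ᵥ c₂) < 0) {t : ℝ} (ht : 0 < t) :
    thetaRay c₁ c₂ p q Ω t = ∑' n, signTerm c₁ c₂ p q Ω n t - ∑' n, tailTerm c₂ p q Ω n t +
      ∑' n, tailTerm c₁ p q Ω n t := by
  have hs : (g : ℝ) / 2 < (((g : ℝ) / 2 + 1 : ℝ) : ℂ).re := by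
    rw [Complex.ofReal_re]
    linarith
  have h0 := (signTerm_series (p := p) (q := q) hj hsig hc₁ hc₂ hc hs).1 t ht
  have h1 := (tailTerm_series (p := p) (q := q) hj hsig hc₁ hs).1 t ht
  have h2 := (tailTerm_series (p := p) (q := q) hj hsig hc₂ hs).1 t ht
  rw [thetaRay, thetaChar, theta, ← tsum_mul_left]
  simp only [e_mul_thetaTerm_smul hΩ hc₁ hc₂ ht]
  rw [(h0.sub h2).tsum_add h1, h0.tsum_sub h2]

/-- The completed indefinite zeta function as a cone Dirichlet series with correction terms. -/
lemma hasMellin_thetaRay {j : ℕ} (hj : j + 1 = g) (hsig : HasSignature (imPart Ω) j 1)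
    (hΩ : Ω.IsSymm) (hc₁ : qf (imPart Ω) c₁ < 0) (hc₂ : qf (imPart Ω) c₂ < 0)
    (hc : c₁ ⬝ᵥ (imPart Ω *ᵥ c₂) < 0) (hs : (g : ℝ) / 2 < s.re) :
    HasMellin (thetaRay c₁ c₂ p q Ω) s
      ((Real.pi : ℂ) ^ (-s) * Complex.Gamma s * coneZeta c₁ c₂ p q Ω s -
        Complex.Gamma (s + 1 / 2) * (Real.pi : ℂ) ^ (-(s + 1 / 2)) * xi c₂ p q Ω s +
        Complex.Gamma (s + 1 / 2) * (Real.pi : ℂ) ^ (-(s + 1 / 2)) * xi c₁ p q Ω s) := by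
  have h0 := (signTerm_series (p := p) (q := q) hj hsig hc₁ hc₂ hc hs).2.1
  have h1 := (tailTerm_series (p := p) (q := q) hj hsig hc₁ hs).2.1
  have h2 := (tailTerm_series (p := p) (q := q) hj hsig hc₂ hs).2.1
  have h02 := hasMellin_sub h0 h2
  have h := hasMellin_add h02.1 h1
  rw [h02.2, mellin_tsum_signTerm hj hsig hc₁ hc₂ hc hs, mellin_tsum_tailTerm hj hsig hc₁ hs,
    mellin_tsum_tailTerm hj hsig hc₂ hs] at h
  refine ⟨h.1.congr_fun (fun t ht => ?_) measurableSet_Ioi, ?_⟩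
  · simp only [thetaRay_eq hj hsig hΩ hc₁ hc₂ hc ht]
  · rw [← h.2]
    refine setIntegral_congr_fun measurableSet_Ioi fun t ht => ?_
    simp only [thetaRay_eq hj hsig hΩ hc₁ hc₂ hc ht]

end Series

end IndefZeta

end

theorem theorem6 {g : ℕ} (P : Matrix.GeneralLinearGroup (Fin g) ℤ) (c₁ c₂ p q : Fin g → ℝ)
    (Ω : Matrix (Fin g) (Fin g) ℂ)
    (hstab : IndefZeta.IsPStable P c₁ c₂
      (IndefZeta.toC p + Matrix.mulVec Ω (IndefZeta.toC q)) Ω)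
    (s : ℂ) (hs : (g : ℝ) / 2 < s.re) :
    (Summable (IndefZeta.xiTerm c₁ p q Ω s) ∧ Summable (IndefZeta.xiTerm c₂ p q Ω s) ∧
      IndefZeta.xi c₁ p q Ω s = IndefZeta.xi c₂ p q Ω s) ∧
    (dotProduct c₁ (Matrix.mulVec (IndefZeta.imPart Ω) c₂) < 0 →
      (∀ t : ℝ, 0 < t → Summable (IndefZeta.thetaTerm c₁ c₂
        (IndefZeta.toC p + Matrix.mulVec ((t : ℂ) • Ω) (IndefZeta.toC q)) ((t : ℂ) • Ω))) ∧
      MellinConvergent (IndefZeta.thetaRay c₁ c₂ p q Ω) s ∧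
      Summable (IndefZeta.coneTerm c₁ c₂ p q Ω s) ∧
      IndefZeta.completedZeta c₁ c₂ p q Ω s =
        (Real.pi : ℂ) ^ (-s) * Complex.Gamma s * IndefZeta.coneZeta c₁ c₂ p q Ω s) := by
  obtain ⟨hΩ, j, hj, hsig⟩ := hstab.mem
  have hxi : IndefZeta.xi c₁ p q Ω s = IndefZeta.xi c₂ p q Ω s := by
    -- Reindexing the sum for c₂ by the lattice permutation P matches it summand by summand with the
    -- sum for c₁.
    rw [IndefZeta.xi, IndefZeta.xi, ← (IndefZeta.latticeEquiv P).tsum_eq (IndefZeta.xiTerm c₂ p q Ω s)]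
    simp only [hstab.xiTerm_latticeEquiv s]
  refine ⟨⟨IndefZeta.summable_xiTerm hj hsig hstab.neg₁ hs,
    IndefZeta.summable_xiTerm hj hsig hstab.neg₂ hs, hxi⟩, fun hc => ?_⟩
  have h := IndefZeta.hasMellin_thetaRay (p := p) (q := q) hj hsig hΩ hstab.neg₁ hstab.neg₂ hc hs
  refine ⟨fun t ht => IndefZeta.summable_thetaTerm_smul hj hsig hΩ hstab.neg₁ hstab.neg₂ hc ht,
    h.1, IndefZeta.summable_coneTerm hj hsig hstab.neg₁ hstab.neg₂ hc hs, ?_⟩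
  rw [IndefZeta.completedZeta, h.2, hxi]
  ring
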